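/- **Theorem (Bound on approximation error for ITL and VTL).** Let $k$ be a positive semidefinite kernel on a set $\mathcal X$ with $k(x,x)\le 1$ for all $x\in\mathcal X$, with reproducing kernel Hilbert space $\mathcal H_k(\mathcal X)$. Let $\rho:\mathcal X\to(0,\infty)$ be bounded with $\rho_{\max}=\sup_{x\in\mathcal X}\rho(x)$ (for constant noise level, $\rho(x)\equiv\rho$). Let $\mathcal A,\mathcal S\subseteq\mathcal X$ be finite. *Model.* Let $f\sim\mathrm{GP}(0,k)$, and for a finite sequence (or multiset) $X=(x_1,\dots,x_m)$ of points let $y_X$ be observations $f(x_i)+\epsilon_i$ with independent noise $\epsilon_i\sim\mathcal N(0,\rho^2(x_i))$. Let $K_{XX}=(k(x_i,x_j))_{i,j}$ and $P_X=\mathrm{diag}(\rho^2(x_1),\dots,\rho^2(x_m))$. After observations $y_{1:n}$ at $X=x_{1:n}$, the posterior is a Gaussian process with mean and covariance $$\mu_n(x)=K_{xX}(K_{XX}+P_X)^{-1}y_{1:n},\qquad k_n(x,x')=k(x,x')-K_{xX}(K_{XX}+P_X)^{-1}K_{Xx'},$$ and $\sigma_n^2(x)=k_n(x,x)$. Write $\eta_{\mathcal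 S}^2(x)=\mathrm{Var}[f_x\mid f_{\mathcal S}]$ for the irreducible uncertainty, $I(f_{\mathcal A};y_X)=\frac12(\log\det\mathrm{Var}[y_X]-\log\det\mathrm{Var}[y_X\mid f_{\mathcal A}])$ for the information gain, and $$\gamma_{\mathcal A,\mathcal S}(n)=\max_{X\subseteq\mathcal S,\,|X|\le n}I(f_{\mathcal A};y_X),\qquad \gamma_n=\sup_{X\subseteq\mathcal X,\,|X|\le n}\tfrac12\log\det(I+P_X^{-1}K_{XX}),$$ where $X$ ranges over finite multisets. Assume that $\gamma_n$ is finite for all $n$ and sublinear in $n$. *Decision rule.* Data are selected by one of the two rules, at every round $n\geq1$, with arbitrary tie-breaking: ITL, $x_n\in\arg\max_{x\in\mathcal S}I(f_{\mathcal A};y_x\mid\mathcal D_{n-1})$, or VTL, $x_n\in\arg\min_{x\in\mathcal S}\operatorname{tr}\mathrm{Var}[f_{\mathcal A}\mid\mathcal D_{n-1},y_x]$, where $\mathcal D_{n-1}$ is the data of the first $n-1$ rounds and information and variance are those of the model. Put $\psi_{\mathcal A}(X)=I(f_{\mathcal A};y_X)$ for ITL and $\psi_{\mathcal A}(X)=\operatorname{tr}\mathrm{Var}[f_{\mathcal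 A}]-\operatorname{tr}\mathrm{Var}[f_{\mathcal A}\mid y_X]$ for VTL. Assume that $\psi_{\mathcal A}$ is submodular: for all $x\in\mathcal S$ and all finite multisets $X'\subseteq X$ of points of $\mathcal S$, $\psi_{\mathcal A}(X'\cup\{x\})-\psi_{\mathcal A}(X')\ge\psi_{\mathcal A}(X\cup\{x\})-\psi_{\mathcal A}(X)$ (unions with multiplicity). Then there is a constant $C\ge0$, depending only on $k,\rho,\mathcal A,\mathcal S$ and the rule, such that with $\nu_{\mathcal A,\mathcal S}^2(n)=C\,\gamma_{\mathcal A,\mathcal S}(n)/\sqrt n$ the following two statements hold. 1. For every sequence selected by the rule, every $n\ge1$ and every $x\in\mathcal A$, $\ \sigma_n^2(x)\le\eta_{\mathcal S}^2(x)+\nu_{\mathcal A,\mathcal S}^2(n)$. 2. Let $f^\star\in\mathcal H_k(\mathcal X)$ and $\delta\in(0,1)$. Let $x_n$ (selected by the rule) and $\varepsilon_n$ be random variables with observations $y_n=f^\star(x_n)+\varepsilon_n$, where $\varepsilon_n$ is conditionally $\rho(x_n)$-sub-Gaussian: $\mathbb E[e^{\lambda\varepsilon_n}\mid x_1,\varepsilon_1,\dots,x_{n-1},\varepsilon_{n-1},x_n]\le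 e^{\lambda^2\rho^2(x_n)/2}$ almost surely, for all $n\ge1$ and $\lambda\in\mathbb R$. Let $$\beta_n(\delta)=\|f^\star\|_k+\rho_{\max}\sqrt{2(\gamma_n+1+\log(1/\delta))}.$$ Then with probability at least $1-\delta$, jointly for all $n\ge1$ and all $x\in\mathcal A$, $$|f^\star(x)-\mu_n(x)|\le\beta_n(\delta)\,[\eta_{\mathcal S}(x)+\nu_{\mathcal A,\mathcal S}(n)].$$ -/

import Mathlib

open MeasureTheory

noncomputable section

namespace TransductiveLearning

variable {X : Type*}

/-- The kernel matrix `K_{xz}`, with entries `k (x i) (z j)`. -/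
def gram {ι κ : Type*} (k : X → X → ℝ) (x : ι → X) (z : κ → X) : Matrix ι κ ℝ :=
  Matrix.of fun i j => k (x i) (z j)

/-- The noise covariance matrix `P_x = diag (ρ² (x 1), …, ρ² (x n))`. -/
def noiseCov {ι : Type*} [DecidableEq ι] (ρ : X → ℝ) (x : ι → X) : Matrix ι ι ℝ :=
  Matrix.diagonal fun i => ρ (x i) ^ 2

/-- The posterior mean at `a` of a centred Gaussian process with kernel `k`, given the
observations `y i` at the points `x i`, with independent Gaussian noise of variance `ρ² (x i)`. -/
def posteriorMean {n : ℕ} (k : X → X → ℝ) (ρ : X → ℝ) (x : Fin n → X) (y : Fin n → ℝ)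
    (a : X) : ℝ :=
  (fun i => k a (x i)) ⬝ᵥ (Matrix.mulVec (gram k x x + noiseCov ρ x)⁻¹ y)

/-- The posterior covariance function `k_n` of the Gaussian process, given noisy observations at
the points `x i`.  (It does not depend on the observed values.) -/
def posteriorKernel {n : ℕ} (k : X → X → ℝ) (ρ : X → ℝ) (x : Fin n → X) (a b : X) : ℝ :=
  k a b - (fun i => k a (x i)) ⬝ᵥ
    (Matrix.mulVec (gram k x x + noiseCov ρ x)⁻¹ (fun i => k (x i) b))

/-- The posterior variance `σ_n²`. -/
def posteriorVar {n : ℕ} (k : X → X → ℝ) (ρ : X → ℝ) (x : Fin n → X) (a : X) : ℝ :=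
  posteriorKernel k ρ x a a

/-- The Moore–Penrose inverse of a real symmetric matrix: the nonzero eigenvalues are inverted
and the eigenvalue `0` is kept.  For an invertible symmetric matrix it is the inverse. -/
def pinv {ι : Type*} [Fintype ι] [DecidableEq ι] (M : Matrix ι ι ℝ) : Matrix ι ι ℝ :=
  cfc (fun t : ℝ => t⁻¹) M

open Classical in
/-- The conditional covariance `Cov (f_a, f_b ∣ f_B)` of a Gaussian process with kernel `k`, given
its (noiseless) values on the finite set `B`: `k a b - K_{aB} K_{BB}⁺ K_{Bb}`.  The
Moore–Penrose inverse makes this correct also when `K_{BB}` is singular. -/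
def condKernel (k : X → X → ℝ) (B : Finset X) (a b : X) : ℝ :=
  k a b - (fun i : B => k a i) ⬝ᵥ
    (Matrix.mulVec (pinv (gram k (fun i : B => (i : X)) (fun i : B => (i : X))))
      (fun i : B => k i b))

/-- The irreducible uncertainty `η_S² (a) = Var (f_a ∣ f_S)`. -/
def irreducibleVar (k : X → X → ℝ) (S : Finset X) (a : X) : ℝ :=
  condKernel k S a a

/-- The information gain `I (f_A; y_x) = ½ (log det Var (y_x) - log det Var (y_x ∣ f_A))` about
the values on `A` from noisy observations at `x 1, …, x m` (with independent noise, so that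
repeated points are independent observations), for a Gaussian process with kernel `k`. -/
def infoGain {m : ℕ} (k : X → X → ℝ) (ρ : X → ℝ) (A : Finset X) (x : Fin m → X) : ℝ :=
  (1 / 2) * (Real.log (gram k x x + noiseCov ρ x).det
    - Real.log (gram (condKernel k A) x x + noiseCov ρ x).det)

/-- The information capacity `γ_{A,S} (n)`: the maximum of `I (f_A; y_x)` over all multisets `x` of
at most `n` points of `S`. -/
def infoCapacity (k : X → X → ℝ) (ρ : X → ℝ) (A S : Finset X) (n : ℕ) : ℝ :=
  sSup {r | ∃ m ≤ n, ∃ x : Fin m → X, (∀ i, x i ∈ S) ∧ r = infoGain k ρ A x}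

/-- The values `I (f_x; y_x) = ½ log det (1 + P_x⁻¹ K_{xx})`, over all multisets `x` of at most `n`
points of the whole domain. -/
def totalInfoValues (k : X → X → ℝ) (ρ : X → ℝ) (n : ℕ) : Set ℝ :=
  {r | ∃ m ≤ n, ∃ x : Fin m → X,
    r = (1 / 2) * Real.log (1 + (noiseCov ρ x)⁻¹ * gram k x x).det}

/-- The information capacity `γ_n` of the whole domain. -/
def totalInfoCapacity (k : X → X → ℝ) (ρ : X → ℝ) (n : ℕ) : ℝ :=
  sSup (totalInfoValues k ρ n)

/-- `γ_n` is finite for every `n`, and sublinear in `n`. -/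
def HasSublinearCapacity (k : X → X → ℝ) (ρ : X → ℝ) : Prop :=
  (∀ n, BddAbove (totalInfoValues k ρ n)) ∧
    (fun n : ℕ => totalInfoCapacity k ρ n) =o[Filter.atTop] (fun n : ℕ => (n : ℝ))

/-- The sequence `x` extended by the point `z`. -/
def extend {m : ℕ} (x : Fin m → X) (z : X) : Fin (m + 1) → X :=
  Fin.snoc (α := fun _ => X) x z

/-- The two decision rules. -/
inductive DecisionRule
  | itl
  | vtl

/-- The (non-myopic) objective `ψ_A` of a decision rule: the information gain `I (f_A; y_x)` for ITL,
and the variance reduction `tr Var (f_A) - tr Var (f_A ∣ y_x)` for VTL. -/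
def psi (rule : DecisionRule) (k : X → X → ℝ) (ρ : X → ℝ) (A : Finset X) {m : ℕ}
    (x : Fin m → X) : ℝ :=
  match rule with
  | .itl => infoGain k ρ A x
  | .vtl => ∑ a ∈ A, k a a - ∑ a ∈ A, posteriorVar k ρ x a

/-- Submodularity of `ψ_A` on multisets of points of `S`: the gain from adding `z ∈ S` to a multiset
is at most the gain from adding it to a sub-multiset.  The multiset is listed as `x`, and its
sub-multisets are the `x ∘ e` with `e` injective. -/
def IsSubmodular (rule : DecisionRule) (k : X → X → ℝ) (ρ : X → ℝ) (A S : Finset X) : Prop :=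
  ∀ (m' m : ℕ) (e : Fin m' ↪ Fin m) (x : Fin m → X), (∀ i, x i ∈ S) → ∀ z ∈ S,
    psi rule k ρ A (extend x z) - psi rule k ρ A x ≤
      psi rule k ρ A (extend (x ∘ e) z) - psi rule k ρ A (x ∘ e)

/-- The point `z` is a choice of the decision rule after observations at `x`:
for ITL, `z ∈ argmax_{S} I (f_A; y_z ∣ D)`, the information gain under the posterior process;
for VTL, `z ∈ argmin_{S} tr Var (f_A ∣ D, y_z)`. -/
def IsChoice (rule : DecisionRule) (k : X → X → ℝ) (ρ : X → ℝ) (A S : Finset X) {m : ℕ}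
    (x : Fin m → X) (z : X) : Prop :=
  match rule with
  | .itl => z ∈ S ∧ ∀ w ∈ S,
      infoGain (posteriorKernel k ρ x) ρ A ![w] ≤ infoGain (posteriorKernel k ρ x) ρ A ![z]
  | .vtl => z ∈ S ∧ ∀ w ∈ S,
      ∑ a ∈ A, posteriorVar k ρ (extend x z) a ≤ ∑ a ∈ A, posteriorVar k ρ (extend x w) a

/-- The sequence `x 0, x 1, …` of points is selected by the decision rule. -/
def IsSelectedBy (rule : DecisionRule) (k : X → X → ℝ) (ρ : X → ℝ) (A S : Finset X)
    (x : ℕ → X) : Prop :=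
  ∀ n, IsChoice rule k ρ A S (fun i : Fin n => x i) (x n)

/-- The σ-algebra generated by `x i, ε i` for `i < n`, and by `x n`. -/
@[reducible] def history {Ω : Type*} [MeasurableSpace X] (x : ℕ → Ω → X) (ε : ℕ → Ω → ℝ) (n : ℕ) :
    MeasurableSpace Ω :=
  (⨆ i : Fin n, (MeasurableSpace.comap (x i) inferInstance ⊔
    MeasurableSpace.comap (ε i) inferInstance)) ⊔ MeasurableSpace.comap (x n) inferInstance

/-- The noise `ε n` is conditionally `ρ (x n)`-sub-Gaussian given the history, for every `n`. -/
def IsCondSubGaussian {Ω : Type*} [MeasurableSpace Ω] (P : Measure Ω) [MeasurableSpace X]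
    (ρ : X → ℝ) (x : ℕ → Ω → X) (ε : ℕ → Ω → ℝ) : Prop :=
  ∀ (n : ℕ) (t : ℝ), Integrable (fun ω => Real.exp (t * ε n ω)) P ∧
    P[fun ω => Real.exp (t * ε n ω) | history x ε n] ≤ᵐ[P]
      fun ω => Real.exp (t ^ 2 * ρ (x n ω) ^ 2 / 2)

/-- The confidence width `β_n (δ) = B + ρ √(2 (γ_n + 1 + log (1/δ)))`, where `B` is the norm of the
unknown function and `ρ` the maximum of `ρ (x)` over the domain. -/
def confidenceWidth (k : X → X → ℝ) (ρ : X → ℝ) (B : ℝ) (n : ℕ) (δ : ℝ) : ℝ :=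
  B + (⨆ x, ρ x) * √(2 * (totalInfoCapacity k ρ n + 1 + Real.log (1 / δ)))

/-- The reducible part `ν_{A,S}² (n) = C γ_{A,S} (n) / √n` of the variance bound. -/
def reducibleVar (C : ℝ) (k : X → X → ℝ) (ρ : X → ℝ) (A S : Finset X) (n : ℕ) : ℝ :=
  C * (infoCapacity k ρ A S n / √(n : ℝ))

end TransductiveLearning

end

/-! Write the kernel as an inner product of features `φ`, and represent a noisy observation at `x i`
by the pair of `φ (x i)` and `ρ (x i)` times the `i`-th basis vector of a separate noise space. The
Gram matrix of these pairs is `K + P`, so posterior covariances are inner products of residuals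
after an orthogonal projection (`posteriorKernel_eq_inner`). Conditioning on `f_A` is a projection
too, and the two can be done in either order (`condKernel_posteriorKernel`). Hence the chain rule
`infoGain_extend`, and the fact that one observation lowers each variance on `A` by at most twice
the information it gains.

Variance bound. By submodularity and greediness, the gain still available at any `z ∈ S` after `n`
rounds is at most the average gain so far (`IsSelectedBy.mul_gain_le`), which is of order `γ / n`
for `γ = γ_{A,S}(n)`. The variance drop that `z` would cause at `a` controls the square of their
posterior covariance, so all covariances of `a` with `S` are of order `√(γ / n)`. The excess of the
posterior over the irreducible variance is a fixed linear combination of them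
(`posteriorVar_sub_irreducibleVar`). The rate `γ / √n` follows from `√γ ≤ γ / √γ₁`, with `γ₁` the
capacity of one observation.

Confidence bound. The component of `φ a` orthogonal to the features of `S` never meets the data and
costs at most `‖f‖ η`. The remaining component has posterior variance `σ² - η²` and meets the noise
only through `noiseForm`. Up to a determinant, `exp (noiseForm / 2)` is the likelihood ratio of
noisy process values against pure noise. Each factor of this ratio is a Gaussian mixture of `exp (t
y - t² ρ² / 2)`, so sub-Gaussian noise makes the ratio a supermartingale, and `ville_inequality`
bounds it at all times at once. Taking logarithms bounds `noiseForm` by `2 (γ_n + log (1 / δ))`. -/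

namespace TransductiveLearning

/-! ### Residuals of orthogonal projections -/

section Residual

variable {E : Type*} [NormedAddCommGroup E] [InnerProductSpace ℝ E]

/-- The residual of `b` after orthogonal projection onto the span of the finite family `v`. -/
noncomputable def resid {ι : Type*} [Finite ι] (v : ι → E) : E →L[ℝ] E :=
  haveI : FiniteDimensional ℝ (Submodule.span ℝ (Set.range v)) :=
    FiniteDimensional.span_of_finite ℝ (Set.finite_range v)
  (Submodule.span ℝ (Set.range v))ᗮ.starProjection

variable {ι κ : Type*} [Finite ι] [Finite κ]

lemma sub_resid_mem (v : ι → E) (b : E) : b - resid v b ∈ Submodule.span ℝ (Set.range v) := by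
  have : FiniteDimensional ℝ (Submodule.span ℝ (Set.range v)) :=
    FiniteDimensional.span_of_finite ℝ (Set.finite_range v)
  rw [resid, Submodule.starProjection_orthogonal_val, sub_sub_cancel]
  exact Submodule.starProjection_apply_mem _ _

lemma resid_mem (v : ι → E) (b : E) : resid v b ∈ (Submodule.span ℝ (Set.range v))ᗮ := by
  have : FiniteDimensional ℝ (Submodule.span ℝ (Set.range v)) :=
    FiniteDimensional.span_of_finite ℝ (Set.finite_range v)
  exact Submodule.starProjection_apply_mem _ _

lemma inner_resid (v : ι → E) (b : E) (i : ι) : inner ℝ (v i) (resid v b) = 0 :=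
  Submodule.inner_right_of_mem_orthogonal (Submodule.subset_span (Set.mem_range_self i))
    (resid_mem v b)

lemma mem_orthogonal_span_range {ι : Type*} {v : ι → E} {r : E} (h : ∀ i, inner ℝ (v i) r = 0) :
    r ∈ (Submodule.span ℝ (Set.range v))ᗮ := by
  rw [Submodule.mem_orthogonal]
  intro u hu
  induction hu using Submodule.span_induction with
  | mem x hx => obtain ⟨i, rfl⟩ := hx; exact h i
  | zero => simp
  | add x y _ _ hx hy => rw [inner_add_left, hx, hy, add_zero]
  | smul c x _ hx => rw [real_inner_smul_left, hx, mul_zero]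

/-- The residual is characterised by orthogonality to the family, up to its span. -/
lemma eq_resid {v : ι → E} {b r : E} (h1 : b - r ∈ Submodule.span ℝ (Set.range v))
    (h2 : ∀ i, inner ℝ (v i) r = 0) : r = resid v b := by
  have ho := Submodule.sub_mem _ (mem_orthogonal_span_range h2) (resid_mem v b)
  have hs : r - resid v b ∈ Submodule.span ℝ (Set.range v) := by
    have := Submodule.sub_mem _ (sub_resid_mem v b) h1
    rwa [show b - resid v b - (b - r) = r - resid v b by abel] at this
  have := Submodule.inner_right_of_mem_orthogonal hs ho
  exact sub_eq_zero.1 (inner_self_eq_zero.1 this)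

lemma resid_of_orthogonal {v : ι → E} {r : E} (h : ∀ i, inner ℝ (v i) r = 0) : resid v r = r :=
  (eq_resid (by simp) h).symm

lemma resid_of_mem_span {v : ι → E} {b : E} (h : b ∈ Submodule.span ℝ (Set.range v)) :
    resid v b = 0 :=
  (eq_resid (by simpa using h) (by simp)).symm

lemma inner_resid_right (v : ι → E) (a b : E) :
    inner ℝ (resid v a) (resid v b) = inner ℝ a (resid v b) := by
  have := Submodule.inner_right_of_mem_orthogonal (sub_resid_mem v a) (resid_mem v b)
  rw [inner_sub_left] at this
  linarith

lemma norm_resid_le (v : ι → E) (b : E) : ‖resid v b‖ ≤ ‖b‖ := by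
  have h := (inner_resid_right v b b).trans_le (real_inner_le_norm _ _)
  rw [real_inner_self_eq_norm_mul_norm] at h
  rcases (norm_nonneg (resid v b)).eq_or_lt with h0 | h0
  · rw [← h0]; exact norm_nonneg b
  · exact le_of_mul_le_mul_right h h0

/-- Removing `v` and then the residuals of `u` removes `v` and `u` jointly. -/
lemma resid_resid (v : ι → E) (u : κ → E) (b : E) :
    resid (fun j => resid v (u j)) (resid v b) = resid (Sum.elim v u) b := by
  set r := resid (Sum.elim v u) b with hr
  have hv : ∀ i, inner ℝ (v i) r = 0 := fun i => inner_resid (Sum.elim v u) b (Sum.inl i)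
  have hu : ∀ j, inner ℝ (u j) r = 0 := fun j => inner_resid (Sum.elim v u) b (Sum.inr j)
  symm
  apply eq_resid
  -- `r` is its own residual against `v`, so the difference is the image of an element of the joint
  -- span under the linear map `resid v`. This map kills `v` and sends `u` to its residuals.
  · rw [← resid_of_orthogonal hv, ← map_sub]
    have := Submodule.mem_map_of_mem (f := (resid v).toLinearMap)
      (sub_resid_mem (Sum.elim v u) b)
    rw [Submodule.map_span] at this
    refine Submodule.span_le.2 ?_ this
    rintro _ ⟨_, ⟨i | j, rfl⟩, rfl⟩
    · have : resid v (v i) = 0 := resid_of_mem_span (Submodule.subset_span ⟨i, rfl⟩)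
      simp [this]
    · exact Submodule.subset_span ⟨j, rfl⟩
  · intro j
    have h := Submodule.inner_right_of_mem_orthogonal (sub_resid_mem v (u j))
      (mem_orthogonal_span_range hv)
    rw [inner_sub_left, hu j] at h
    linarith

lemma resid_sum_comm (v : ι → E) (u : κ → E) (b : E) :
    resid (Sum.elim v u) b = resid (Sum.elim u v) b := by
  apply eq_resid
  · have := sub_resid_mem (Sum.elim v u) b
    rwa [Set.Sum.elim_range, Set.union_comm, ← Set.Sum.elim_range] at this
  · rintro (j | i)
    · exact inner_resid (Sum.elim v u) b (Sum.inr j)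
    · exact inner_resid (Sum.elim v u) b (Sum.inl i)

end Residual

section FintypeResidual

variable {E : Type*} [NormedAddCommGroup E] [InnerProductSpace ℝ E] {ι : Type*} [Fintype ι]

/-- If `β` solves the normal equations, the residual is `b - ∑ β i • v i`. -/
lemma resid_eq_of_normal {v : ι → E} {b : E} {β : ι → ℝ}
    (h : ∀ i, ∑ j, inner ℝ (v i) (v j) * β j = inner ℝ (v i) b) :
    resid v b = b - ∑ j, β j • v j := by
  symm
  apply eq_resid
  · rw [sub_sub_cancel]
    exact Submodule.sum_mem _ fun j _ => Submodule.smul_mem _ _ (Submodule.subset_span ⟨j, rfl⟩)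
  · intro i
    rw [inner_sub_right, inner_sum, ← h i]
    simp [real_inner_smul_right, mul_comm]

lemma exists_normal (v : ι → E) (b : E) :
    ∃ β : ι → ℝ, ∀ i, ∑ j, inner ℝ (v i) (v j) * β j = inner ℝ (v i) b := by
  obtain ⟨β, hβ⟩ := (Submodule.mem_span_range_iff_exists_fun ℝ).1 (sub_resid_mem v b)
  refine ⟨β, fun i => ?_⟩
  have := congrArg (inner ℝ (v i)) hβ
  rw [inner_sub_right, inner_resid, sub_zero, inner_sum] at this
  simpa [real_inner_smul_right, mul_comm] using this

lemma inner_resid_of_normal {v : ι → E} {a b : E} {β : ι → ℝ}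
    (h : ∀ i, ∑ j, inner ℝ (v i) (v j) * β j = inner ℝ (v i) b) :
    inner ℝ (resid v a) (resid v b) = inner ℝ a b - ∑ j, inner ℝ a (v j) * β j := by
  rw [inner_resid_right, resid_eq_of_normal h, inner_sub_right, inner_sum]
  simp [real_inner_smul_right, mul_comm]

end FintypeResidual

/-! ### Moore–Penrose inverse and noiseless conditioning -/

section Pinv

variable {ι : Type*} [Fintype ι] [DecidableEq ι]

lemma mul_pinv_mul {M : Matrix ι ι ℝ} (hM : M.IsHermitian) : M * pinv M * M = M := by
  have hsa : IsSelfAdjoint M := hM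
  have hc : ∀ f : ℝ → ℝ, ContinuousOn f (spectrum ℝ M) := fun f =>
    (Matrix.finite_real_spectrum (A := M)).continuousOn f
  have hid : cfc (fun t : ℝ => t) M = M := cfc_id' ℝ M
  calc M * pinv M * M
      = cfc (fun t : ℝ => t) M * cfc (fun t : ℝ => t⁻¹) M * cfc (fun t : ℝ => t) M := by
        rw [hid, pinv]
    _ = cfc (fun t : ℝ => t * t⁻¹ * t) M := by
        rw [← cfc_mul _ _ M (hc _) (hc _), ← cfc_mul _ _ M (hc _) (hc _)]
    _ = M := by simp [hid]

/-- From `M M⁺ M = M`: the pseudoinverse solves every consistent system, even a singular one. -/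
lemma mulVec_pinv {M : Matrix ι ι ℝ} (hM : M.IsHermitian) {u v : ι → ℝ} (h : M.mulVec u = v) :
    M.mulVec ((pinv M).mulVec v) = v := by
  rw [← h, Matrix.mulVec_mulVec, Matrix.mulVec_mulVec, mul_pinv_mul hM]

end Pinv

variable {X : Type*} {E : Type*} [NormedAddCommGroup E] [InnerProductSpace ℝ E]

lemma gram_isHermitian {k : X → X → ℝ} {φ : X → E} (hφ : ∀ a b, k a b = inner ℝ (φ a) (φ b))
    {ι : Type*} (x : ι → X) : (gram k x x).IsHermitian := by
  ext i j
  simp [gram, hφ, real_inner_comm]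

/-- The weights of the regression of `b` on the finite set `B`. -/
noncomputable def condWeights (k : X → X → ℝ) (B : Finset X) (b : X) : B → ℝ :=
  haveI := Classical.decEq X
  (pinv (gram k (fun i : B => (i : X)) (fun i : B => (i : X)))).mulVec (fun i : B => k i b)

lemma condKernel_eq_sub (k : X → X → ℝ) (B : Finset X) (a b : X) :
    condKernel k B a b = k a b - ∑ j : B, k a j * condWeights k B b j := by
  unfold condKernel condWeights dotProduct
  congr!

/-- The projection of `φ b` onto the span exists, so the normal equations are consistent and the
pseudoinverse solves them without any independence of the features. -/
lemma condWeights_normal {k : X → X → ℝ} {φ : X → E} (hφ : ∀ a b, k a b = inner ℝ (φ a) (φ b))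
    (B : Finset X) (b : X) (i : B) :
    ∑ j : B, inner ℝ (φ i) (φ j) * condWeights k B b j = inner ℝ (φ i) (φ b) := by
  classical
  obtain ⟨β, hβ⟩ := exists_normal (fun j : B => φ j) (φ b)
  have h : (gram k (fun i : B => (i : X)) (fun i : B => (i : X))).mulVec β =
      fun i : B => k i b := by
    ext i
    simpa [gram, Matrix.mulVec, dotProduct, hφ] using hβ i
  have := congrFun (mulVec_pinv (gram_isHermitian hφ _) h) i
  simp only [← hφ]
  convert this using 1
  unfold condWeights gram Matrix.mulVec dotProduct
  congr!

lemma condKernel_eq_inner {k : X → X → ℝ} {φ : X → E} (hφ : ∀ a b, k a b = inner ℝ (φ a) (φ b))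
    (B : Finset X) (a b : X) :
    condKernel k B a b =
      inner ℝ (resid (fun i : B => φ i) (φ a)) (resid (fun i : B => φ i) (φ b)) := by
  rw [inner_resid_of_normal (condWeights_normal hφ B b), condKernel_eq_sub]
  simp only [hφ]

/-! ### The posterior process as a residual process -/

section Posterior

variable {X : Type*} {E : Type*} [NormedAddCommGroup E] [InnerProductSpace ℝ E]

/-- The covariance matrix of the noisy observations at `x`. -/
noncomputable def obsCov {ι : Type*} [DecidableEq ι] (k : X → X → ℝ) (ρ : X → ℝ) (x : ι → X) :
    Matrix ι ι ℝ :=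
  gram k x x + noiseCov ρ x

lemma obsCov_posDef {k : X → X → ℝ} {φ : X → E} (hφ : ∀ a b, k a b = inner ℝ (φ a) (φ b))
    {ρ : X → ℝ} (hρ : ∀ a, 0 < ρ a) {ι : Type*} [Fintype ι] [DecidableEq ι] (x : ι → X) :
    (obsCov k ρ x).PosDef := by
  have h1 : (gram k x x).PosSemidef := by
    have : gram k x x = Matrix.gram ℝ (φ ∘ x) := by
      ext i j
      simp [gram, Matrix.gram, hφ]
    rw [this]
    exact Matrix.posSemidef_gram ℝ _
  have h2 : (noiseCov ρ x).PosDef := by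
    rw [noiseCov, Matrix.posDef_diagonal_iff]
    exact fun i => pow_pos (hρ _) 2
  exact Matrix.PosDef.posSemidef_add h1 h2

lemma obsCov_det_pos {k : X → X → ℝ} {φ : X → E} (hφ : ∀ a b, k a b = inner ℝ (φ a) (φ b))
    {ρ : X → ℝ} (hρ : ∀ a, 0 < ρ a) {ι : Type*} [Fintype ι] [DecidableEq ι] (x : ι → X) :
    0 < (obsCov k ρ x).det :=
  (obsCov_posDef hφ hρ x).det_pos

lemma obsCov_isUnit_det {k : X → X → ℝ} {φ : X → E} (hφ : ∀ a b, k a b = inner ℝ (φ a) (φ b))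
    {ρ : X → ℝ} (hρ : ∀ a, 0 < ρ a) {ι : Type*} [Fintype ι] [DecidableEq ι] (x : ι → X) :
    IsUnit (obsCov k ρ x).det :=
  (obsCov_det_pos hφ hρ x).ne'.isUnit

/-- The vector of a noiseless value in the product of the feature space and the noise space. -/
noncomputable def liftVec (n : ℕ) (p : E) : WithLp 2 (E × EuclideanSpace ℝ (Fin n)) :=
  WithLp.toLp 2 (p, 0)

/-- The vector of the noisy observation `i` in the product of the feature and the noise space. -/
noncomputable def obsVec {n : ℕ} (φ : X → E) (ρ : X → ℝ) (x : Fin n → X) (i : Fin n) :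
    WithLp 2 (E × EuclideanSpace ℝ (Fin n)) :=
  WithLp.toLp 2 (φ (x i), EuclideanSpace.single i (ρ (x i)))

@[simp]
lemma inner_liftVec (n : ℕ) (p q : E) : inner ℝ (liftVec n p) (liftVec n q) = inner ℝ p q := by
  simp [liftVec, WithLp.prod_inner_apply]

@[simp]
lemma inner_liftVec_obsVec {n : ℕ} (φ : X → E) (ρ : X → ℝ) (x : Fin n → X) (p : E) (i : Fin n) :
    inner ℝ (liftVec n p) (obsVec φ ρ x i) = inner ℝ p (φ (x i)) := by
  simp [liftVec, obsVec, WithLp.prod_inner_apply]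

@[simp]
lemma inner_obsVec_liftVec {n : ℕ} (φ : X → E) (ρ : X → ℝ) (x : Fin n → X) (p : E) (i : Fin n) :
    inner ℝ (obsVec φ ρ x i) (liftVec n p) = inner ℝ (φ (x i)) p := by
  simp [liftVec, obsVec, WithLp.prod_inner_apply]

lemma inner_obsVec {k : X → X → ℝ} {φ : X → E} (hφ : ∀ a b, k a b = inner ℝ (φ a) (φ b))
    {n : ℕ} (ρ : X → ℝ) (x : Fin n → X) (i j : Fin n) :
    inner ℝ (obsVec φ ρ x i) (obsVec φ ρ x j) = obsCov k ρ x i j := by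
  rcases eq_or_ne i j with rfl | h
  · rw [obsVec, WithLp.prod_inner_apply, EuclideanSpace.inner_single_left]
    simp [obsCov, gram, noiseCov, hφ, sq]
  · rw [obsVec, obsVec, WithLp.prod_inner_apply, EuclideanSpace.inner_single_left]
    simp [obsCov, gram, noiseCov, hφ, h]

/-- The features of the posterior process. -/
noncomputable def posteriorFeature {n : ℕ} (φ : X → E) (ρ : X → ℝ) (x : Fin n → X) (a : X) :
    WithLp 2 (E × EuclideanSpace ℝ (Fin n)) :=
  resid (obsVec φ ρ x) (liftVec n (φ a))

/-- The Gram matrix of the observation vectors is the invertible `obsCov`, so its inverse solves the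
normal equations. Arbitrary `u` and `v` are allowed because noise vectors are inserted later,
besides lifted features. -/
lemma inner_resid_obsVec {k : X → X → ℝ} {φ : X → E}
    (hφ : ∀ a b, k a b = inner ℝ (φ a) (φ b)) {ρ : X → ℝ} (hρ : ∀ a, 0 < ρ a)
    {n : ℕ} (x : Fin n → X) (u v : WithLp 2 (E × EuclideanSpace ℝ (Fin n))) :
    inner ℝ (resid (obsVec φ ρ x) u) (resid (obsVec φ ρ x) v) =
      inner ℝ u v - (fun i => inner ℝ u (obsVec φ ρ x i)) ⬝ᵥ
        (obsCov k ρ x)⁻¹.mulVec (fun i => inner ℝ (obsVec φ ρ x i) v) := by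
  rw [inner_resid_of_normal (β := (obsCov k ρ x)⁻¹.mulVec (fun i => inner ℝ (obsVec φ ρ x i) v))]
  · rfl
  · intro i
    simp only [inner_obsVec hφ]
    change (obsCov k ρ x).mulVec ((obsCov k ρ x)⁻¹.mulVec _) i = _
    rw [Matrix.mulVec_mulVec, Matrix.mul_nonsing_inv _ (obsCov_isUnit_det hφ hρ x),
      Matrix.one_mulVec]

lemma posteriorKernel_eq_inner {k : X → X → ℝ} {φ : X → E}
    (hφ : ∀ a b, k a b = inner ℝ (φ a) (φ b)) {ρ : X → ℝ} (hρ : ∀ a, 0 < ρ a)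
    {n : ℕ} (x : Fin n → X) (a b : X) :
    posteriorKernel k ρ x a b =
      inner ℝ (posteriorFeature φ ρ x a) (posteriorFeature φ ρ x b) := by
  rw [posteriorFeature, posteriorFeature, inner_resid_obsVec hφ hρ]
  simp only [inner_liftVec, inner_liftVec_obsVec, inner_obsVec_liftVec, ← hφ]
  rfl

lemma posteriorVar_nonneg {k : X → X → ℝ} {φ : X → E}
    (hφ : ∀ a b, k a b = inner ℝ (φ a) (φ b)) {ρ : X → ℝ} (hρ : ∀ a, 0 < ρ a)
    {n : ℕ} (x : Fin n → X) (a : X) : 0 ≤ posteriorVar k ρ x a := by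
  rw [posteriorVar, posteriorKernel_eq_inner hφ hρ]
  exact real_inner_self_nonneg

/-- Conditioning on the values on `A` commutes with conditioning on the observations at `x`. -/
lemma condKernel_posteriorKernel {k : X → X → ℝ} {φ : X → E}
    (hφ : ∀ a b, k a b = inner ℝ (φ a) (φ b)) {ρ : X → ℝ} (hρ : ∀ a, 0 < ρ a)
    (A : Finset X) {n : ℕ} (x : Fin n → X) (a b : X) :
    condKernel (posteriorKernel k ρ x) A a b = posteriorKernel (condKernel k A) ρ x a b := by
  rw [condKernel_eq_inner (posteriorKernel_eq_inner hφ hρ x),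
    posteriorKernel_eq_inner (condKernel_eq_inner hφ A) hρ]
  set u : A → WithLp 2 (E × EuclideanSpace ℝ (Fin n)) := fun i => liftVec n (φ i) with hu
  have hlift : ∀ p : E, liftVec n (resid (fun i : A => φ i) p) = resid u (liftVec n p) := by
    intro p
    apply eq_resid
    · obtain ⟨β, hβ⟩ := (Submodule.mem_span_range_iff_exists_fun ℝ).1
        (sub_resid_mem (fun i : A => φ i) p)
      rw [Submodule.mem_span_range_iff_exists_fun]
      refine ⟨β, ?_⟩
      let L : E →ₗ[ℝ] WithLp 2 (E × EuclideanSpace ℝ (Fin n)) :=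
        (WithLp.linearEquiv 2 ℝ (E × EuclideanSpace ℝ (Fin n))).symm.toLinearMap ∘ₗ
          LinearMap.inl ℝ E (EuclideanSpace ℝ (Fin n))
      have hL : ∀ q, liftVec n q = L q := fun q => rfl
      simp only [hu, hL, ← map_smul, ← map_sum, ← map_sub, hβ]
    · intro i
      rw [hu]
      simp only [inner_liftVec]
      exact inner_resid (fun i : A => φ i) p i
  -- The lifted features of `A` have no noise component, so removing them changes only the feature
  -- component of an observation.
  have hobs : ∀ i, obsVec (fun a => resid (fun i : A => φ i) (φ a)) ρ x i =
      resid u (obsVec φ ρ x i) := by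
    intro i
    apply eq_resid
    · have h1 : obsVec φ ρ x i - obsVec (fun a => resid (fun i : A => φ i) (φ a)) ρ x i =
          liftVec n (φ (x i)) - resid u (liftVec n (φ (x i))) := by
        rw [← hlift]
        simp [obsVec, liftVec, ← WithLp.toLp_sub]
      rw [h1]
      exact sub_resid_mem _ _
    · intro j
      rw [hu]
      simp only [inner_liftVec_obsVec]
      exact inner_resid (fun i : A => φ i) _ j
  -- Both orders of conditioning remove the joint span of the observations and the features of `A`.
  have key : ∀ c, resid (fun i : A => posteriorFeature φ ρ x i) (posteriorFeature φ ρ x c) =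
      posteriorFeature (fun a => resid (fun i : A => φ i) (φ a)) ρ x c := by
    intro c
    unfold posteriorFeature
    rw [resid_resid, resid_sum_comm, ← resid_resid, hlift, funext hobs]
  rw [key, key]

/-- Noiseless conditioning on a set that contains `a` reduces the variance at `w` by at least what
the correlation with `a` explains. -/
lemma sq_le_mul_sub_condKernel {k : X → X → ℝ} {φ : X → E}
    (hφ : ∀ a b, k a b = inner ℝ (φ a) (φ b)) {A : Finset X} {a : X} (ha : a ∈ A) (w : X) :
    k a w ^ 2 ≤ k a a * (k w w - condKernel k A w w) := by
  set r := resid (fun i : A => φ i) (φ w) with hr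
  have h0 : inner ℝ (φ a) r = 0 := inner_resid (fun i : A => φ i) (φ w) ⟨a, ha⟩
  have h1 : inner ℝ (φ a) (φ w - r) = k a w := by rw [inner_sub_right, h0, hφ, sub_zero]
  have h2 : inner ℝ (φ w - r) (φ w - r) = k w w - condKernel k A w w := by
    have h3 : inner ℝ r r = inner ℝ (φ w) r := inner_resid_right _ _ _
    rw [condKernel_eq_inner hφ, ← hr, inner_sub_left, inner_sub_right, inner_sub_right,
      real_inner_comm (φ w) r, ← hφ]
    linarith
  rw [← h1, ← h2, hφ, sq]
  exact real_inner_mul_inner_self_le _ _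

lemma condKernel_self_nonneg {k : X → X → ℝ} {φ : X → E}
    (hφ : ∀ a b, k a b = inner ℝ (φ a) (φ b)) (A : Finset X) (w : X) :
    0 ≤ condKernel k A w w := by
  rw [condKernel_eq_inner hφ]
  exact real_inner_self_nonneg

end Posterior
-- Adding one observation: rank-one updates and information gain
section Extend

variable {X : Type*} {E : Type*} [NormedAddCommGroup E] [InnerProductSpace ℝ E]

@[simp]
lemma extend_castSucc {m : ℕ} (x : Fin m → X) (z : X) (i : Fin m) :
    extend x z i.castSucc = x i := by
  simp [extend]

@[simp]
lemma extend_last {m : ℕ} (x : Fin m → X) (z : X) : extend x z (Fin.last m) = z := by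
  simp [extend]

lemma extend_prefix (x : ℕ → X) (n : ℕ) :
    extend (fun i : Fin n => x i) (x n) = fun i : Fin (n + 1) => x i := by
  ext i
  refine Fin.lastCases ?_ (fun j => ?_) i <;> simp

variable {k : X → X → ℝ} {ρ : X → ℝ} {n : ℕ}

lemma posteriorKernel_def (x : Fin n → X) (a b : X) :
    posteriorKernel k ρ x a b = k a b -
      (fun i => k a (x i)) ⬝ᵥ (obsCov k ρ x)⁻¹.mulVec (fun i => k (x i) b) := rfl

lemma infoGain_def (A : Finset X) (x : Fin n → X) :
    infoGain k ρ A x = (1 / 2) * (Real.log (obsCov k ρ x).det -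
      Real.log (obsCov (condKernel k A) ρ x).det) := rfl

@[simp]
lemma obsCov_extend_castSucc (x : Fin n → X) (z : X) (i j : Fin n) :
    obsCov k ρ (extend x z) i.castSucc j.castSucc = obsCov k ρ x i j := by
  simp [obsCov, gram, noiseCov, Matrix.diagonal_apply]

@[simp]
lemma obsCov_extend_castSucc_last (x : Fin n → X) (z : X) (i : Fin n) :
    obsCov k ρ (extend x z) i.castSucc (Fin.last n) = k (x i) z := by
  simp [obsCov, gram, noiseCov, Fin.castSucc_ne_last]

@[simp]
lemma obsCov_extend_last_castSucc (x : Fin n → X) (z : X) (i : Fin n) :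
    obsCov k ρ (extend x z) (Fin.last n) i.castSucc = k z (x i) := by
  simp [obsCov, gram, noiseCov, (Fin.castSucc_ne_last i).symm]

@[simp]
lemma obsCov_extend_last (x : Fin n → X) (z : X) :
    obsCov k ρ (extend x z) (Fin.last n) (Fin.last n) = k z z + ρ z ^ 2 := by
  simp [obsCov, gram, noiseCov]

/-- The second factor is the Schur complement of the old block: the predictive variance of the new
observation. -/
lemma obsCov_extend_det {φ : X → E} (hφ : ∀ a b, k a b = inner ℝ (φ a) (φ b))
    (hρ : ∀ a, 0 < ρ a) (x : Fin n → X) (z : X) :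
    (obsCov k ρ (extend x z)).det =
      (obsCov k ρ x).det * (posteriorVar k ρ x z + ρ z ^ 2) := by
  have hblock : Matrix.reindex finSumFinEquiv.symm finSumFinEquiv.symm
      (obsCov k ρ (extend x z)) = Matrix.fromBlocks (obsCov k ρ x)
        (Matrix.of fun i (_ : Fin 1) => k (x i) z) (Matrix.of fun (_ : Fin 1) i => k z (x i))
        (Matrix.of fun (_ _ : Fin 1) => k z z + ρ z ^ 2) := by
    ext (i | i) (j | j)
    · exact obsCov_extend_castSucc x z i j
    · obtain rfl := Subsingleton.elim j 0
      exact obsCov_extend_castSucc_last x z i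
    · obtain rfl := Subsingleton.elim i 0
      exact obsCov_extend_last_castSucc x z j
    · obtain rfl := Subsingleton.elim i 0
      obtain rfl := Subsingleton.elim j 0
      exact obsCov_extend_last x z
  have : Invertible (obsCov k ρ x) :=
    Matrix.invertibleOfIsUnitDet _ (obsCov_isUnit_det hφ hρ x)
  rw [← Matrix.det_reindex_self finSumFinEquiv.symm, hblock, Matrix.det_fromBlocks₁₁,
    Matrix.invOf_eq_nonsing_inv]
  congr 1
  rw [Matrix.det_unique, posteriorVar, posteriorKernel]
  simp only [Matrix.sub_apply, Matrix.of_apply, Matrix.mul_assoc]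
  rw [add_sub_right_comm]
  congr 2

/-- The inverse covariance form after one more observation. -/
lemma dotProduct_obsCov_extend_inv {φ : X → E} (hφ : ∀ a b, k a b = inner ℝ (φ a) (φ b))
    (hρ : ∀ a, 0 < ρ a) (x : Fin n → X) (z : X) (u v : Fin (n + 1) → ℝ) :
    u ⬝ᵥ (obsCov k ρ (extend x z))⁻¹.mulVec v =
      (fun i => u (Fin.castSucc i)) ⬝ᵥ (obsCov k ρ x)⁻¹.mulVec (fun i => v (Fin.castSucc i)) +
      (u (Fin.last n) -
        (fun i => u (Fin.castSucc i)) ⬝ᵥ (obsCov k ρ x)⁻¹.mulVec (fun i => k (x i) z)) *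
      (v (Fin.last n) -
        (fun i => k z (x i)) ⬝ᵥ (obsCov k ρ x)⁻¹.mulVec (fun i => v (Fin.castSucc i))) /
      (posteriorVar k ρ x z + ρ z ^ 2) := by
  set N := obsCov k ρ x with hN
  set c : Fin n → ℝ := fun i => k (x i) z with hc
  set v' : Fin n → ℝ := fun i => v (Fin.castSucc i) with hv'
  set s := posteriorVar k ρ x z + ρ z ^ 2 with hs
  have hspos : 0 < s := add_pos_of_nonneg_of_pos (posteriorVar_nonneg hφ hρ x z) (pow_pos (hρ z) 2)
  set t := (v (Fin.last n) - (fun i => k z (x i)) ⬝ᵥ N⁻¹.mulVec v') / s with ht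
  have hNN : ∀ w, N.mulVec (N⁻¹.mulVec w) = w := by
    intro w
    rw [Matrix.mulVec_mulVec, Matrix.mul_nonsing_inv _ (obsCov_isUnit_det hφ hρ x),
      Matrix.one_mulVec]
  set p : Fin n → ℝ := N⁻¹.mulVec v' - t • N⁻¹.mulVec c with hp
  -- Block elimination: the Schur complement `s` determines the last coordinate `t`, and back
  -- substitution gives `p`.
  have hsol : (obsCov k ρ (extend x z)).mulVec (Fin.snoc (α := fun _ => ℝ) p t) = v := by
    ext i
    refine Fin.lastCases ?_ (fun j => ?_) i
    · have e1 : (fun i => k z (x i)) ⬝ᵥ p + (k z z + ρ z ^ 2) * t = v (Fin.last n) := by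
        have e2 : k z z + ρ z ^ 2 = s + (fun i => k z (x i)) ⬝ᵥ N⁻¹.mulVec c := by
          rw [hs, posteriorVar, posteriorKernel]
          change _ = k z z - (fun i => k z (x i)) ⬝ᵥ N⁻¹.mulVec c + _ + _
          ring
        rw [hp, dotProduct_sub, dotProduct_smul, e2, smul_eq_mul]
        have : s * t = v (Fin.last n) - (fun i => k z (x i)) ⬝ᵥ N⁻¹.mulVec v' := by
          rw [ht]; field_simp
        linear_combination this
      rw [Matrix.mulVec, dotProduct, Fin.sum_univ_castSucc]
      simpa [dotProduct] using e1
    · have e1 : N.mulVec p j + c j * t = v' j := by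
        rw [hp, Matrix.mulVec_sub, Matrix.mulVec_smul, hNN, hNN]
        simp only [Pi.sub_apply, Pi.smul_apply, smul_eq_mul]
        ring
      rw [Matrix.mulVec, dotProduct, Fin.sum_univ_castSucc]
      simpa [Matrix.mulVec, dotProduct] using e1
  rw [← hsol, Matrix.mulVec_mulVec,
    Matrix.nonsing_inv_mul _ (obsCov_isUnit_det hφ hρ (extend x z)), Matrix.one_mulVec,
    dotProduct, Fin.sum_univ_castSucc, hsol]
  simp only [Fin.snoc_castSucc, Fin.snoc_last]
  change (fun i => u (Fin.castSucc i)) ⬝ᵥ p + u (Fin.last n) * t = _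
  rw [hp, dotProduct_sub, dotProduct_smul, mul_div_assoc, ← ht, smul_eq_mul]
  ring

lemma posteriorKernel_extend {φ : X → E} (hφ : ∀ a b, k a b = inner ℝ (φ a) (φ b))
    (hρ : ∀ a, 0 < ρ a) (x : Fin n → X) (z a b : X) :
    posteriorKernel k ρ (extend x z) a b = posteriorKernel k ρ x a b -
      posteriorKernel k ρ x a z * posteriorKernel k ρ x z b /
        (posteriorVar k ρ x z + ρ z ^ 2) := by
  have := dotProduct_obsCov_extend_inv hφ hρ x z (fun i => k a (extend x z i))
    (fun i => k (extend x z i) b)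
  simp only [extend_castSucc, extend_last] at this
  simp only [posteriorKernel_def]
  rw [this]
  ring

lemma posteriorKernel_comm {φ : X → E} (hφ : ∀ a b, k a b = inner ℝ (φ a) (φ b))
    (hρ : ∀ a, 0 < ρ a) (x : Fin n → X) (a b : X) :
    posteriorKernel k ρ x a b = posteriorKernel k ρ x b a := by
  rw [posteriorKernel_eq_inner hφ hρ, posteriorKernel_eq_inner hφ hρ, real_inner_comm]

lemma posteriorVar_extend {φ : X → E} (hφ : ∀ a b, k a b = inner ℝ (φ a) (φ b))
    (hρ : ∀ a, 0 < ρ a) (x : Fin n → X) (z a : X) :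
    posteriorVar k ρ (extend x z) a = posteriorVar k ρ x a -
      posteriorKernel k ρ x a z ^ 2 / (posteriorVar k ρ x z + ρ z ^ 2) := by
  rw [posteriorVar, posteriorKernel_extend hφ hρ, posteriorKernel_comm hφ hρ x z a, ← sq]
  rfl

lemma posteriorKernel_empty (x : Fin 0 → X) : posteriorKernel k ρ x = k := by
  ext a b
  simp [posteriorKernel, dotProduct]

lemma posteriorVar_le {φ : X → E} (hφ : ∀ a b, k a b = inner ℝ (φ a) (φ b))
    (hρ : ∀ a, 0 < ρ a) (x : Fin n → X) (a : X) : posteriorVar k ρ x a ≤ k a a := by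
  induction n with
  | zero => rw [posteriorVar, posteriorKernel_empty]
  | succ n ih =>
    have hx : x = extend (Fin.init x) (x (Fin.last n)) := (Fin.snoc_init_self x).symm
    rw [hx, posteriorVar_extend hφ hρ]
    have := posteriorVar_nonneg hφ hρ (Fin.init x) (x (Fin.last n))
    exact (sub_le_self _ (by positivity)).trans (ih _)

lemma infoGain_empty (A : Finset X) (x : Fin 0 → X) : infoGain k ρ A x = 0 := by
  simp [infoGain]

lemma infoGain_singleton (A : Finset X) (z : X) :
    infoGain k ρ A ![z] = (1 / 2) * (Real.log (k z z + ρ z ^ 2) -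
      Real.log (condKernel k A z z + ρ z ^ 2)) := by
  simp [infoGain, Matrix.det_unique, gram, noiseCov]

/-- The chain rule for the information gain. -/
lemma infoGain_extend {φ : X → E} (hφ : ∀ a b, k a b = inner ℝ (φ a) (φ b))
    (hρ : ∀ a, 0 < ρ a) (A : Finset X) (x : Fin n → X) (z : X) :
    infoGain k ρ A (extend x z) = infoGain k ρ A x + infoGain (posteriorKernel k ρ x) ρ A ![z] := by
  have hc := condKernel_eq_inner hφ A
  rw [infoGain_singleton, condKernel_posteriorKernel hφ hρ]
  simp only [infoGain_def]
  rw [obsCov_extend_det hφ hρ, obsCov_extend_det hc hρ]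
  have p1 := pow_pos (hρ z) 2
  have p2 := posteriorVar_nonneg hφ hρ x z
  have p3 := posteriorVar_nonneg hc hρ x z
  rw [Real.log_mul (obsCov_det_pos hφ hρ x).ne' (by positivity),
    Real.log_mul (obsCov_det_pos hc hρ x).ne' (by positivity)]
  simp only [posteriorVar]
  ring

/-- The information gain of one observation dominates the relative variance reduction. -/
lemma le_infoGain_singleton {φ : X → E} (hφ : ∀ a b, k a b = inner ℝ (φ a) (φ b))
    (hk1 : ∀ a, k a a ≤ 1) (hρ : ∀ a, 0 < ρ a) {A : Finset X} {a : X} (ha : a ∈ A) (z : X) :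
    k a z ^ 2 / (k z z + ρ z ^ 2) ≤ 2 * infoGain k ρ A ![z] := by
  rw [infoGain_singleton]
  have h0 := condKernel_self_nonneg hφ A z
  have hz : 0 ≤ k z z := by rw [hφ]; exact real_inner_self_nonneg
  have ha0 : 0 ≤ k a a := by rw [hφ]; exact real_inner_self_nonneg
  have h1 := sq_le_mul_sub_condKernel hφ ha z
  have p1 := pow_pos (hρ z) 2
  have hX : 0 < k z z + ρ z ^ 2 := by positivity
  have hY : 0 < condKernel k A z z + ρ z ^ 2 := by positivity
  -- Twice the information is `-log (Y / X)`, hence at least `1 - Y / X`, the relative variance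
  -- reduction at `z`.
  have hlog := Real.log_le_sub_one_of_pos (div_pos hY hX)
  rw [Real.log_div hY.ne' hX.ne'] at hlog
  have h2 : k a z ^ 2 ≤ k z z - condKernel k A z z := by
    rcases le_or_gt 0 (k z z - condKernel k A z z) with h | h
    · exact h1.trans (mul_le_of_le_one_left h (hk1 a))
    -- The difference is the squared norm of the projection of `φ z` onto the features of `A`, so it
    -- is not negative.
    · exfalso
      have h3 := inner_resid_right (fun i : A => φ i) (φ z) (φ z)
      have h4 := condKernel_eq_inner hφ A z z
      have h5 := norm_sub_sq_real (φ z) (resid (fun i : A => φ i) (φ z))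
      rw [← real_inner_self_eq_norm_sq (φ z), ← real_inner_self_eq_norm_sq (resid _ _), ← hφ,
        ← h3, ← h4] at h5
      nlinarith [sq_nonneg ‖φ z - resid (fun i : A => φ i) (φ z)‖]
  have h6 : k a z ^ 2 / (k z z + ρ z ^ 2) ≤
      1 - (condKernel k A z z + ρ z ^ 2) / (k z z + ρ z ^ 2) := by
    rw [one_sub_div hX.ne']
    gcongr
    linarith
  linarith

/-- One observation reduces each variance on `A` by at most twice the gain of information. -/
lemma posteriorVar_sub_extend_le {φ : X → E} (hφ : ∀ a b, k a b = inner ℝ (φ a) (φ b))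
    (hk1 : ∀ a, k a a ≤ 1) (hρ : ∀ a, 0 < ρ a) {A : Finset X} {a : X} (ha : a ∈ A)
    (x : Fin n → X) (z : X) :
    posteriorVar k ρ x a - posteriorVar k ρ (extend x z) a ≤
      2 * (infoGain k ρ A (extend x z) - infoGain k ρ A x) := by
  rw [posteriorVar_extend hφ hρ, infoGain_extend hφ hρ]
  -- The posterior kernel has features of its own and a diagonal still bounded by one, so the
  -- one-observation bound applies to it.
  have := le_infoGain_singleton (posteriorKernel_eq_inner hφ hρ x)
    (fun b => (posteriorVar_le hφ hρ x b).trans (hk1 b)) hρ ha z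
  simp only [posteriorVar]
  linarith

lemma sub_posteriorVar_le {φ : X → E} (hφ : ∀ a b, k a b = inner ℝ (φ a) (φ b))
    (hk1 : ∀ a, k a a ≤ 1) (hρ : ∀ a, 0 < ρ a) {A : Finset X} {a : X} (ha : a ∈ A)
    (x : Fin n → X) :
    k a a - posteriorVar k ρ x a ≤ 2 * infoGain k ρ A x := by
  induction n with
  | zero => rw [posteriorVar, posteriorKernel_empty, infoGain_empty]; simp
  | succ n ih =>
    have hx : x = extend (Fin.init x) (x (Fin.last n)) := (Fin.snoc_init_self x).symm
    have h1 := ih (Fin.init x)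
    have h2 := posteriorVar_sub_extend_le hφ hk1 hρ ha (Fin.init x) (x (Fin.last n))
    rw [hx]
    linarith

/-- A large posterior covariance of `a` and `z` lets an observation at `z` reduce the variance. -/
lemma sq_posteriorKernel_le {φ : X → E} (hφ : ∀ a b, k a b = inner ℝ (φ a) (φ b))
    (hk1 : ∀ a, k a a ≤ 1) (hρ : ∀ a, 0 < ρ a) {R : ℝ} (hR : ∀ a, ρ a ≤ R)
    (x : Fin n → X) (z a : X) :
    posteriorKernel k ρ x a z ^ 2 ≤
      (1 + R ^ 2) * (posteriorVar k ρ x a - posteriorVar k ρ (extend x z) a) := by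
  rw [posteriorVar_extend hφ hρ, sub_sub_cancel]
  have p1 := pow_pos (hρ z) 2
  have p2 := posteriorVar_nonneg hφ hρ x z
  have h1 : posteriorVar k ρ x z + ρ z ^ 2 ≤ 1 + R ^ 2 :=
    add_le_add ((posteriorVar_le hφ hρ x z).trans (hk1 z))
      (pow_le_pow_left₀ (hρ z).le (hR z) 2)
  rw [mul_div_assoc', le_div_iff₀ (by positivity), mul_comm]
  gcongr

end Extend

/-! ### Information capacity -/

section Capacity

variable {X : Type*} {k : X → X → ℝ} {ρ : X → ℝ} {A S : Finset X} {n m : ℕ}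

/-- A finite `S` admits finitely many sequences of length at most `n`; hence the supremum in
`infoCapacity` is over a bounded set. -/
lemma finite_infoGain_values (k : X → X → ℝ) (ρ : X → ℝ) (A S : Finset X) (n : ℕ) :
    {r | ∃ m ≤ n, ∃ x : Fin m → X, (∀ i, x i ∈ S) ∧ r = infoGain k ρ A x}.Finite := by
  have : (⋃ m ∈ Set.Iic n, Set.range fun x : Fin m → S =>
      infoGain k ρ A fun i => (x i : X)).Finite :=
    (Set.finite_Iic n).biUnion fun m _ => Set.finite_range _
  refine this.subset ?_
  rintro r ⟨m, hm, x, hx, rfl⟩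
  exact Set.mem_biUnion (Set.mem_Iic.2 hm) ⟨fun i => ⟨x i, hx i⟩, rfl⟩

lemma infoGain_le_infoCapacity (hm : m ≤ n) {x : Fin m → X} (hx : ∀ i, x i ∈ S) :
    infoGain k ρ A x ≤ infoCapacity k ρ A S n :=
  le_csSup (finite_infoGain_values k ρ A S n).bddAbove ⟨m, hm, x, hx, rfl⟩

lemma infoCapacity_nonneg (k : X → X → ℝ) (ρ : X → ℝ) (A S : Finset X) (n : ℕ) :
    0 ≤ infoCapacity k ρ A S n := by
  have := infoGain_le_infoCapacity (k := k) (ρ := ρ) (A := A) (S := S) (Nat.zero_le n)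
    (x := Fin.elim0) (fun i => i.elim0)
  rwa [infoGain_empty] at this

lemma infoCapacity_mono (k : X → X → ℝ) (ρ : X → ℝ) (A S : Finset X) :
    Monotone (infoCapacity k ρ A S) := by
  intro m n hmn
  refine csSup_le_csSup (finite_infoGain_values k ρ A S n).bddAbove
    ⟨_, 0, Nat.zero_le _, Fin.elim0, fun i => i.elim0, rfl⟩ ?_
  rintro r ⟨l, hl, x, hx, rfl⟩
  exact ⟨l, hl.trans hmn, x, hx, rfl⟩

lemma reducibleVar_mono {C C' : ℝ} (h : C ≤ C') (k : X → X → ℝ) (ρ : X → ℝ) (A S : Finset X)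
    (n : ℕ) : reducibleVar C k ρ A S n ≤ reducibleVar C' k ρ A S n := by
  have := infoCapacity_nonneg k ρ A S n
  unfold reducibleVar
  gcongr

lemma reducibleVar_nonneg {C : ℝ} (h : 0 ≤ C) (k : X → X → ℝ) (ρ : X → ℝ) (A S : Finset X)
    (n : ℕ) : 0 ≤ reducibleVar C k ρ A S n := by
  have := infoCapacity_nonneg k ρ A S n
  unfold reducibleVar
  positivity

end Capacity

/-! ### Greedy selection and the variance bound -/

section Greedy

variable {X : Type*} {E : Type*} [NormedAddCommGroup E] [InnerProductSpace ℝ E]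
  {k : X → X → ℝ} {ρ : X → ℝ} {A S : Finset X} {rule : DecisionRule} {n : ℕ}

lemma IsChoice.mem {x : Fin n → X} {z : X} (h : IsChoice rule k ρ A S x z) : z ∈ S := by
  cases rule <;> exact h.1

lemma IsSelectedBy.mem {x : ℕ → X} (h : IsSelectedBy rule k ρ A S x) (n : ℕ) : x n ∈ S :=
  (h n).mem

lemma psi_empty (x : Fin 0 → X) : psi rule k ρ A x = 0 := by
  cases rule
  · exact infoGain_empty A x
  · simp [psi, posteriorVar, posteriorKernel_empty]

/-- Both rules greedily maximise their objective. -/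
lemma IsChoice.psi_extend_le {φ : X → E} (hφ : ∀ a b, k a b = inner ℝ (φ a) (φ b))
    (hρ : ∀ a, 0 < ρ a) {x : Fin n → X} {z w : X} (h : IsChoice rule k ρ A S x z) (hw : w ∈ S) :
    psi rule k ρ A (extend x w) ≤ psi rule k ρ A (extend x z) := by
  cases rule
  · have := h.2 w hw
    simp only [psi, infoGain_extend hφ hρ]
    linarith
  · have := h.2 w hw
    simp only [psi]
    linarith

/-- For a submodular objective, the gain still available after `n` greedy choices is at most the
average gain of these choices. -/
lemma IsSelectedBy.mul_gain_le {φ : X → E} (hφ : ∀ a b, k a b = inner ℝ (φ a) (φ b))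
    (hρ : ∀ a, 0 < ρ a) (hsub : IsSubmodular rule k ρ A S) {x : ℕ → X}
    (h : IsSelectedBy rule k ρ A S x) (n : ℕ) {z : X} (hz : z ∈ S) :
    n * (psi rule k ρ A (extend (fun i : Fin n => x i) z) -
      psi rule k ρ A (fun i : Fin n => x i)) ≤ psi rule k ρ A (fun i : Fin n => x i) := by
  have hstep : ∀ i ∈ Finset.range n, psi rule k ρ A (extend (fun i : Fin n => x i) z) -
      psi rule k ρ A (fun i : Fin n => x i) ≤
      psi rule k ρ A (fun j : Fin (i + 1) => x j) - psi rule k ρ A (fun j : Fin i => x j) := by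
    intro i hi
    -- `z` gains less after `n` rounds than after the prefix of length `i`, where it competed with
    -- the chosen `x i`. Summing over `i` telescopes.
    have h1 := hsub i n (Fin.castLEEmb (Finset.mem_range.1 hi).le) (fun j : Fin n => x j)
      (fun j => h.mem j) z hz
    have h2 := (h i).psi_extend_le hφ hρ hz
    rw [extend_prefix] at h2
    have h3 : (fun j : Fin n => x j) ∘ Fin.castLEEmb (Finset.mem_range.1 hi).le =
        fun j : Fin i => x j := rfl
    rw [h3] at h1
    linarith
  have := Finset.sum_le_sum hstep
  rw [Finset.sum_range_sub (fun i => psi rule k ρ A (fun j : Fin i => x j)), psi_empty, sub_zero,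
    Finset.sum_const, Finset.card_range, nsmul_eq_mul] at this
  exact this

lemma psi_le_infoGain {φ : X → E} (hφ : ∀ a b, k a b = inner ℝ (φ a) (φ b))
    (hk1 : ∀ a, k a a ≤ 1) (hρ : ∀ a, 0 < ρ a) (x : Fin n → X) :
    psi .vtl k ρ A x ≤ A.card * (2 * infoGain k ρ A x) := by
  simp only [psi]
  rw [← Finset.sum_sub_distrib, ← nsmul_eq_mul]
  exact Finset.sum_le_card_nsmul _ _ _ fun a ha => sub_posteriorVar_le hφ hk1 hρ ha x

lemma posteriorVar_extend_le {φ : X → E} (hφ : ∀ a b, k a b = inner ℝ (φ a) (φ b))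
    (hρ : ∀ a, 0 < ρ a) (x : Fin n → X) (z a : X) :
    posteriorVar k ρ (extend x z) a ≤ posteriorVar k ρ x a := by
  rw [posteriorVar_extend hφ hρ]
  have := posteriorVar_nonneg hφ hρ x z
  exact sub_le_self _ (by positivity)

/-- For ITL the variance drop at `a` is at most twice the information gain. For VTL it is at most
the total drop over `A`, and the objective is at most `2 |A|` times the information. The factor
`|A|`, at least one because `a ∈ A`, serves both rules. -/
lemma IsSelectedBy.mul_posteriorVar_sub_le {φ : X → E}
    (hφ : ∀ a b, k a b = inner ℝ (φ a) (φ b)) (hk1 : ∀ a, k a a ≤ 1)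
    (hρ : ∀ a, 0 < ρ a) (hsub : IsSubmodular rule k ρ A S) {x : ℕ → X}
    (h : IsSelectedBy rule k ρ A S x) (n : ℕ) {z a : X} (hz : z ∈ S) (ha : a ∈ A) :
    n * (posteriorVar k ρ (fun i : Fin n => x i) a -
      posteriorVar k ρ (extend (fun i : Fin n => x i) z) a) ≤
      A.card * (2 * infoCapacity k ρ A S n) := by
  have h1 := h.mul_gain_le hφ hρ hsub n hz
  have h2 : infoGain k ρ A (fun i : Fin n => x i) ≤ infoCapacity k ρ A S n :=
    infoGain_le_infoCapacity le_rfl fun i => h.mem i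
  have hcard : (1 : ℝ) ≤ A.card := by exact_mod_cast Finset.card_pos.2 ⟨a, ha⟩
  have hn : (0 : ℝ) ≤ n := n.cast_nonneg
  cases rule
  · simp only [psi] at h1
    have h3 := mul_le_mul_of_nonneg_left
      (posteriorVar_sub_extend_le hφ hk1 hρ ha (fun i : Fin n => x i) z) hn
    have h4 : 2 * infoCapacity k ρ A S n ≤ A.card * (2 * infoCapacity k ρ A S n) :=
      le_mul_of_one_le_left (mul_nonneg zero_le_two (infoCapacity_nonneg k ρ A S n)) hcard
    linarith
  · have h3 := psi_le_infoGain (A := A) hφ hk1 hρ (fun i : Fin n => x i)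
    have h4 : posteriorVar k ρ (fun i : Fin n => x i) a -
        posteriorVar k ρ (extend (fun i : Fin n => x i) z) a ≤
        psi .vtl k ρ A (extend (fun i : Fin n => x i) z) -
          psi .vtl k ρ A (fun i : Fin n => x i) := by
      simp only [psi]
      rw [sub_sub_sub_cancel_left, ← Finset.sum_sub_distrib]
      exact Finset.single_le_sum (f := fun a => posteriorVar k ρ (fun i : Fin n => x i) a -
        posteriorVar k ρ (extend (fun i : Fin n => x i) z) a)
        (fun b _ => sub_nonneg.2 (posteriorVar_extend_le hφ hρ _ z b)) ha
    have h5 := mul_le_mul_of_nonneg_left h4 hn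
    have h6 : (A.card : ℝ) * (2 * infoGain k ρ A (fun i : Fin n => x i)) ≤
        A.card * (2 * infoCapacity k ρ A S n) := by gcongr
    linarith

/-- The excess of the posterior variance over the irreducible one is a combination of the posterior
covariances with the points of `S`. -/
lemma posteriorVar_sub_irreducibleVar {φ : X → E} (hφ : ∀ a b, k a b = inner ℝ (φ a) (φ b))
    {x : Fin n → X} (hx : ∀ i, x i ∈ S) (a : X) :
    posteriorVar k ρ x a - irreducibleVar k S a =
      ∑ s : S, posteriorKernel k ρ x a s * condWeights k S a s := by
  -- Since `x i ∈ S`, the observations correlate with `a` only through its projection onto the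
  -- features of `S`.
  have h1 : ∀ i, k (x i) a = ∑ s : S, k (x i) s * condWeights k S a s := by
    intro i
    simp only [hφ]
    exact (condWeights_normal hφ S a ⟨x i, hx i⟩).symm
  rw [posteriorVar, irreducibleVar, condKernel_eq_sub]
  simp only [posteriorKernel_def, Matrix.dotProduct_mulVec]
  have h2 : (Matrix.vecMul (fun i => k a (x i)) (obsCov k ρ x)⁻¹ ⬝ᵥ fun i => k (x i) a) =
      ∑ s : S, (Matrix.vecMul (fun i => k a (x i)) (obsCov k ρ x)⁻¹ ⬝ᵥ fun i => k (x i) s) *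
        condWeights k S a s := by
    simp only [dotProduct, Finset.sum_mul]
    rw [Finset.sum_comm]
    refine Finset.sum_congr rfl fun i _ => ?_
    rw [h1 i, Finset.mul_sum]
    exact Finset.sum_congr rfl fun s _ => by ring
  rw [h2]
  simp only [sub_mul, Finset.sum_sub_distrib]
  ring

/-- A constant for the bound on the reducible variance. -/
noncomputable def varConst (k : X → X → ℝ) (A S : Finset X) (R γ₁ : ℝ) : ℝ :=
  (∑ a ∈ A, ∑ s : S, |condWeights k S a s|) * √((1 + R ^ 2) * (A.card * 2)) / √γ₁

lemma varConst_nonneg (k : X → X → ℝ) (A S : Finset X) (R γ₁ : ℝ) : 0 ≤ varConst k A S R γ₁ := by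
  unfold varConst
  positivity

/-- The excess variance is at most the total weight of the regression on `S` times the largest
posterior covariance, `√(D γ / n)`. Summing the weights over `A` makes the constant independent of
`a`. -/
theorem IsSelectedBy.posteriorVar_sub_le {φ : X → E}
    (hφ : ∀ a b, k a b = inner ℝ (φ a) (φ b)) (hk1 : ∀ a, k a a ≤ 1)
    (hρ : ∀ a, 0 < ρ a) {R : ℝ} (hR : ∀ a, ρ a ≤ R) (hsub : IsSubmodular rule k ρ A S)
    {x : ℕ → X} (h : IsSelectedBy rule k ρ A S x) {n : ℕ} (hn : 1 ≤ n) {a : X} (ha : a ∈ A) :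
    posteriorVar k ρ (fun i : Fin n => x i) a - irreducibleVar k S a ≤
      reducibleVar (varConst k A S R (infoCapacity k ρ A S 1)) k ρ A S n := by
  set γ := infoCapacity k ρ A S n with hγ
  set γ₁ := infoCapacity k ρ A S 1 with hγ₁
  have hγ₁0 : 0 ≤ γ₁ := infoCapacity_nonneg k ρ A S 1
  have hγ₁γ : γ₁ ≤ γ := infoCapacity_mono k ρ A S hn
  have hn0 : (0 : ℝ) < n := by exact_mod_cast hn
  set W := ∑ a ∈ A, ∑ s : S, |condWeights k S a s| with hW
  set D := (1 + R ^ 2) * ((A.card : ℝ) * 2) with hD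
  have hD0 : 0 ≤ D := by positivity
  -- If a single observation carries no information, `a` is uncorrelated with all of `S` and its
  -- prior variance is already irreducible. The division by `√γ₁` in the constant is harmless there:
  -- only nonnegativity is used.
  rcases hγ₁0.eq_or_lt with h0 | h0
  · have hzero : ∀ s ∈ S, k a s = 0 := by
      intro s hs
      have h1 := sq_posteriorKernel_le hφ hk1 hρ hR (Fin.elim0 : Fin 0 → X) s a
      have h2 := posteriorVar_sub_extend_le hφ hk1 hρ ha (Fin.elim0 : Fin 0 → X) s
      have h3 : infoGain k ρ A (extend (Fin.elim0 : Fin 0 → X) s) ≤ γ₁ :=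
        infoGain_le_infoCapacity le_rfl fun i => by
          refine Fin.lastCases ?_ (fun j => j.elim0) i
          rwa [extend_last]
      rw [infoGain_empty] at h2
      rw [posteriorKernel_empty] at h1
      have h4 : posteriorVar k ρ (Fin.elim0 : Fin 0 → X) a -
        posteriorVar k ρ (extend (Fin.elim0 : Fin 0 → X) s) a ≤ 0 := by linarith
      have h5 : k a s ^ 2 ≤ 0 :=
        h1.trans (mul_nonpos_of_nonneg_of_nonpos (by positivity) h4)
      exact (pow_eq_zero_iff two_ne_zero).1 (le_antisymm h5 (sq_nonneg _))
    have h1 : irreducibleVar k S a = k a a := by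
      rw [irreducibleVar, condKernel_eq_sub, Finset.sum_eq_zero, sub_zero]
      intro s _
      rw [hzero s s.2, zero_mul]
    have h2 := posteriorVar_le hφ hρ (fun i : Fin n => x i) a
    have h3 := reducibleVar_nonneg (varConst_nonneg k A S R γ₁) k ρ A S n
    linarith
  · have hκ : ∀ s : S, |posteriorKernel k ρ (fun i : Fin n => x i) a s| ≤ √D * √γ / √n := by
      intro s
      have h1 := sq_posteriorKernel_le hφ hk1 hρ hR (fun i : Fin n => x i) s a
      have h2 := h.mul_posteriorVar_sub_le hφ hk1 hρ hsub n s.2 ha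
      have h3 : posteriorKernel k ρ (fun i : Fin n => x i) a s ^ 2 ≤ D * γ / n := by
        refine h1.trans ?_
        rw [le_div_iff₀ hn0, mul_assoc, mul_comm _ (n : ℝ), hD, mul_assoc]
        refine mul_le_mul_of_nonneg_left (h2.trans_eq ?_) (by positivity)
        ring
      rw [← Real.sqrt_mul hD0, ← Real.sqrt_div' _ hn0.le]
      exact Real.abs_le_sqrt h3
    have hγ0 : 0 < γ := h0.trans_le hγ₁γ
    -- The argument gives `√γ / √n`; monotonicity of the capacity trades it for the stated `γ / √n`.
    have hsq : √γ ≤ γ / √γ₁ := by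
      rw [le_div_iff₀ (Real.sqrt_pos.2 h0)]
      calc √γ * √γ₁ ≤ √γ * √γ := by gcongr
        _ = γ := Real.mul_self_sqrt hγ0.le
    calc posteriorVar k ρ (fun i : Fin n => x i) a - irreducibleVar k S a
        = ∑ s : S, posteriorKernel k ρ (fun i : Fin n => x i) a s * condWeights k S a s :=
          posteriorVar_sub_irreducibleVar hφ (fun i => h.mem i) a
      _ ≤ ∑ s : S, √D * √γ / √n * |condWeights k S a s| := by
          refine Finset.sum_le_sum fun s _ => (le_abs_self _).trans ?_
          rw [abs_mul]
          exact mul_le_mul_of_nonneg_right (hκ s) (abs_nonneg _)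
      _ = √D * √γ / √n * ∑ s : S, |condWeights k S a s| := by rw [Finset.mul_sum]
      _ ≤ √D * (γ / √γ₁) / √n * W := by
          gcongr
          exact Finset.single_le_sum (f := fun a => ∑ s : S, |condWeights k S a s|)
            (fun b _ => Finset.sum_nonneg fun s _ => abs_nonneg _) ha
      _ = reducibleVar (varConst k A S R γ₁) k ρ A S n := by
          rw [reducibleVar, varConst, ← hW, ← hD, ← hγ]
          ring

end Greedy

/-! ### Prediction error for fixed noise values -/

section Confidence

variable {X : Type*} {E : Type*} [NormedAddCommGroup E] [InnerProductSpace ℝ E]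
  {k : X → X → ℝ} {ρ : X → ℝ} {S : Finset X} {n : ℕ}

/-- The self-normalised noise: the squared norm of the noise `e`, relative to its covariance, that
is not attributed to the process by the posterior. -/
noncomputable def noiseForm (k : X → X → ℝ) (ρ : X → ℝ) (x : Fin n → X) (e : Fin n → ℝ) : ℝ :=
  ∑ i, e i ^ 2 / ρ (x i) ^ 2 - e ⬝ᵥ (obsCov k ρ x)⁻¹.mulVec e

/-- The standardised noise as a vector of the noise space. -/
noncomputable def noiseVec (E : Type*) [NormedAddCommGroup E] [InnerProductSpace ℝ E]
    (ρ : X → ℝ) (x : Fin n → X) (e : Fin n → ℝ) :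
    WithLp 2 (E × EuclideanSpace ℝ (Fin n)) :=
  WithLp.toLp 2 (0, WithLp.toLp 2 fun i => e i / ρ (x i))

lemma inner_obsVec_noiseVec (φ : X → E) (hρ : ∀ a, 0 < ρ a) (x : Fin n → X) (e : Fin n → ℝ)
    (i : Fin n) : inner ℝ (obsVec φ ρ x i) (noiseVec E ρ x e) = e i := by
  rw [obsVec, noiseVec, WithLp.prod_inner_apply, EuclideanSpace.inner_single_left]
  have := (hρ (x i)).ne'
  simp
  field_simp

lemma inner_liftVec_noiseVec (x : Fin n → X) (e : Fin n → ℝ) (p : E) :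
    inner ℝ (liftVec n p) (noiseVec E ρ x e) = 0 := by
  simp [liftVec, noiseVec, WithLp.prod_inner_apply]

lemma norm_liftVec (n : ℕ) (p : E) : ‖liftVec n p‖ = ‖p‖ := by
  rw [← sq_eq_sq₀ (norm_nonneg _) (norm_nonneg _), ← real_inner_self_eq_norm_sq,
    ← real_inner_self_eq_norm_sq, inner_liftVec]

lemma norm_resid_noiseVec_sq {φ : X → E} (hφ : ∀ a b, k a b = inner ℝ (φ a) (φ b))
    (hρ : ∀ a, 0 < ρ a) (x : Fin n → X) (e : Fin n → ℝ) :
    ‖resid (obsVec φ ρ x) (noiseVec E ρ x e)‖ ^ 2 = noiseForm k ρ x e := by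
  rw [← real_inner_self_eq_norm_sq, inner_resid_obsVec hφ hρ, noiseForm]
  congr 1
  · simp [noiseVec, EuclideanSpace.real_norm_sq_eq, div_pow]
  · simp only [inner_obsVec_noiseVec φ hρ, real_inner_comm (obsVec φ ρ x _) (noiseVec E ρ x e)]

/-- The error of the posterior prediction for the feature vector `p`. -/
lemma abs_error_le {φ : X → E} (hφ : ∀ a b, k a b = inner ℝ (φ a) (φ b))
    (hρ : ∀ a, 0 < ρ a) (x : Fin n → X) (e : Fin n → ℝ) (p f : E) :
    |inner ℝ p f - (fun i => inner ℝ p (φ (x i))) ⬝ᵥ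
        (obsCov k ρ x)⁻¹.mulVec (fun i => inner ℝ (φ (x i)) f + e i)| ≤
      ‖resid (obsVec φ ρ x) (liftVec n p)‖ * (‖f‖ + √(noiseForm k ρ x e)) := by
  set r := resid (obsVec φ ρ x) (liftVec n p) with hr
  -- The data are the inner products of the observation vectors with the lifted `f` plus the noise
  -- vector, so the error is an inner product of residuals and Cauchy–Schwarz applies.
  have h1 : inner ℝ p f - (fun i => inner ℝ p (φ (x i))) ⬝ᵥ
      (obsCov k ρ x)⁻¹.mulVec (fun i => inner ℝ (φ (x i)) f + e i) =
      inner ℝ r (resid (obsVec φ ρ x) (liftVec n f + noiseVec E ρ x e)) := by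
    rw [hr, inner_resid_obsVec hφ hρ]
    simp only [inner_add_right, inner_liftVec, inner_liftVec_noiseVec, inner_liftVec_obsVec,
      inner_obsVec_liftVec, inner_obsVec_noiseVec φ hρ, add_zero]
  have h2 : ‖resid (obsVec φ ρ x) (liftVec n f)‖ ≤ ‖f‖ :=
    (norm_resid_le _ _).trans_eq (norm_liftVec n f)
  rw [h1, map_add]
  refine (abs_real_inner_le_norm _ _).trans ?_
  rw [← norm_resid_noiseVec_sq hφ hρ, Real.sqrt_sq (norm_nonneg _)]
  gcongr
  exact (norm_add_le _ _).trans (by gcongr)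

/-- Split `φ a` into its residual `r` against `S` and its projection. All observed features are
orthogonal to `r`, so noise multiplies only the reducible deviation, never `η`. -/
lemma abs_sub_posteriorMean_le {φ : X → E} (hφ : ∀ a b, k a b = inner ℝ (φ a) (φ b))
    (hρ : ∀ a, 0 < ρ a) {x : Fin n → X} (hx : ∀ i, x i ∈ S) (e : Fin n → ℝ) (f : E) (a : X) :
    |inner ℝ (φ a) f - posteriorMean k ρ x (fun i => inner ℝ (φ (x i)) f + e i) a| ≤
      ‖f‖ * √(irreducibleVar k S a) +
        √(posteriorVar k ρ x a - irreducibleVar k S a) * (‖f‖ + √(noiseForm k ρ x e)) := by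
  set r := resid (fun s : S => φ s) (φ a) with hr
  have hη : irreducibleVar k S a = ‖r‖ ^ 2 := by
    rw [irreducibleVar, condKernel_eq_inner hφ, real_inner_self_eq_norm_sq]
  have hxr : ∀ i, inner ℝ (φ (x i)) r = 0 := fun i =>
    inner_resid (fun s : S => φ s) (φ a) ⟨x i, hx i⟩
  have har : inner ℝ (φ a) r = irreducibleVar k S a := by
    rw [irreducibleVar, condKernel_eq_inner hφ, inner_resid_right]
  have hrr : inner ℝ r r = irreducibleVar k S a := by
    rw [irreducibleVar, condKernel_eq_inner hφ]
  have hl : ∀ i, inner ℝ (φ a - r) (φ (x i)) = k a (x i) := by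
    intro i
    rw [inner_sub_left, real_inner_comm (φ (x i)) r, hxr, sub_zero, hφ]
  have hl' : ∀ i, inner ℝ (φ (x i)) (φ a - r) = k (x i) a := by
    intro i
    rw [inner_sub_right, hxr, sub_zero, hφ]
  have hvar : ‖resid (obsVec φ ρ x) (liftVec n (φ a - r))‖ =
      √(posteriorVar k ρ x a - irreducibleVar k S a) := by
    rw [← Real.sqrt_sq (norm_nonneg (resid _ _)), ← real_inner_self_eq_norm_sq,
      inner_resid_obsVec hφ hρ]
    congr 1
    simp only [inner_liftVec, inner_liftVec_obsVec, inner_obsVec_liftVec, hl, hl']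
    rw [inner_sub_left, inner_sub_right, inner_sub_right, real_inner_comm (φ a) r, hrr, har, ← hφ,
      posteriorVar, posteriorKernel_def]
    ring
  have h := abs_error_le hφ hρ x e (φ a - r) f
  simp only [hl, hvar] at h
  have h2 : inner ℝ (φ a) f - posteriorMean k ρ x (fun i => inner ℝ (φ (x i)) f + e i) a =
      inner ℝ r f + (inner ℝ (φ a - r) f - (fun i => k a (x i)) ⬝ᵥ
        (obsCov k ρ x)⁻¹.mulVec (fun i => inner ℝ (φ (x i)) f + e i)) := by
    rw [inner_sub_left, posteriorMean, obsCov]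
    ring
  rw [h2, hη, Real.sqrt_sq (norm_nonneg _), mul_comm ‖f‖ ‖r‖, ← hη]
  exact (abs_add_le _ _).trans (add_le_add (abs_real_inner_le_norm _ _) h)

end Confidence

/-! ### Likelihood ratio of the process against pure noise -/

section LikelihoodRatio

variable {X : Type*} {E : Type*} [NormedAddCommGroup E] [InnerProductSpace ℝ E]
  {k : X → X → ℝ} {ρ : X → ℝ} {n : ℕ}

/-- The likelihood ratio of `y`, between the variances `v + r ^ 2` with mean `m`, and `r ^ 2` with
mean `0`. -/
noncomputable def ratioStep (m v r y : ℝ) : ℝ :=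
  √(r ^ 2 / (v + r ^ 2)) * Real.exp ((y ^ 2 / r ^ 2 - (y - m) ^ 2 / (v + r ^ 2)) / 2)

/-- The likelihood ratio of the values `e` at `x`, between noisy observations of the Gaussian
process and pure noise. -/
noncomputable def likelihoodRatio (k : X → X → ℝ) (ρ : X → ℝ) (x : Fin n → X)
    (e : Fin n → ℝ) : ℝ :=
  √((noiseCov ρ x).det / (obsCov k ρ x).det) * Real.exp (noiseForm k ρ x e / 2)

lemma noiseCov_det_pos (hρ : ∀ a, 0 < ρ a) (x : Fin n → X) : 0 < (noiseCov ρ x).det := by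
  rw [noiseCov, Matrix.det_diagonal]
  exact Finset.prod_pos fun i _ => pow_pos (hρ _) 2

lemma likelihoodRatio_nonneg (x : Fin n → X) (e : Fin n → ℝ) : 0 ≤ likelihoodRatio k ρ x e := by
  unfold likelihoodRatio
  positivity

lemma likelihoodRatio_empty (x : Fin 0 → X) (e : Fin 0 → ℝ) : likelihoodRatio k ρ x e = 1 := by
  simp [likelihoodRatio, noiseForm, dotProduct]

lemma dotProduct_obsCov_inv_comm {φ : X → E} (hφ : ∀ a b, k a b = inner ℝ (φ a) (φ b))
    (hρ : ∀ a, 0 < ρ a) (x : Fin n → X) (u v : Fin n → ℝ) :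
    u ⬝ᵥ (obsCov k ρ x)⁻¹.mulVec v = v ⬝ᵥ (obsCov k ρ x)⁻¹.mulVec u := by
  have hs : ((obsCov k ρ x)⁻¹).transpose = (obsCov k ρ x)⁻¹ := by
    have := (obsCov_posDef hφ hρ x).isHermitian.inv
    rwa [Matrix.IsHermitian, Matrix.conjTranspose_eq_transpose_of_trivial] at this
  rw [Matrix.dotProduct_mulVec, ← Matrix.mulVec_transpose, hs, dotProduct_comm]

/-- A joint Gaussian density is the product of its predictive densities; the new one has the
posterior mean and the posterior variance plus noise. -/
lemma likelihoodRatio_succ {φ : X → E} (hφ : ∀ a b, k a b = inner ℝ (φ a) (φ b))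
    (hρ : ∀ a, 0 < ρ a) (x : ℕ → X) (e : ℕ → ℝ) (n : ℕ) :
    likelihoodRatio k ρ (fun i : Fin (n + 1) => x i) (fun i : Fin (n + 1) => e i) =
      likelihoodRatio k ρ (fun i : Fin n => x i) (fun i : Fin n => e i) *
        ratioStep (posteriorMean k ρ (fun i : Fin n => x i) (fun i : Fin n => e i) (x n))
          (posteriorVar k ρ (fun i : Fin n => x i) (x n)) (ρ (x n)) (e n) := by
  have hdet := obsCov_extend_det hφ hρ (fun i : Fin n => x i) (x n)
  have hform := dotProduct_obsCov_extend_inv hφ hρ (fun i : Fin n => x i) (x n)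
    (fun i : Fin (n + 1) => e i) (fun i : Fin (n + 1) => e i)
  have hmean : posteriorMean k ρ (fun i : Fin n => x i) (fun i : Fin n => e i) (x n) =
    (fun i : Fin n => k (x n) (x i)) ⬝ᵥ (obsCov k ρ (fun i : Fin n => x i))⁻¹.mulVec
      (fun i : Fin n => e i) := rfl
  rw [extend_prefix] at hdet hform
  simp only [Fin.val_castSucc, Fin.val_last] at hform
  have hsymm : (fun i : Fin n => k (x i) (x n)) = fun i : Fin n => k (x n) (x i) := by
    ext i
    rw [hφ, hφ, real_inner_comm]
  rw [dotProduct_obsCov_inv_comm hφ hρ _ (fun i : Fin n => e i) (fun i : Fin n => k (x i) (x n)),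
    hsymm, ← hmean] at hform
  have hnoise : (noiseCov ρ (fun i : Fin (n + 1) => x i)).det =
      (noiseCov ρ (fun i : Fin n => x i)).det * ρ (x n) ^ 2 := by
    simp [noiseCov, Matrix.det_diagonal, Fin.prod_univ_castSucc]
  have hq : noiseForm k ρ (fun i : Fin (n + 1) => x i) (fun i : Fin (n + 1) => e i) =
      noiseForm k ρ (fun i : Fin n => x i) (fun i : Fin n => e i) +
      (e n ^ 2 / ρ (x n) ^ 2 - (e n - posteriorMean k ρ (fun i : Fin n => x i)
        (fun i : Fin n => e i) (x n)) ^ 2 /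
        (posteriorVar k ρ (fun i : Fin n => x i) (x n) + ρ (x n) ^ 2)) := by
    simp only [noiseForm]
    rw [hform, Fin.sum_univ_castSucc]
    simp only [Fin.val_castSucc, Fin.val_last]
    ring
  have hd := noiseCov_det_pos hρ (fun i : Fin n => x i)
  have hd' := obsCov_det_pos hφ hρ (fun i : Fin n => x i)
  rw [likelihoodRatio, likelihoodRatio, ratioStep, hdet, hnoise, hq, add_div, Real.exp_add,
    mul_div_mul_comm, Real.sqrt_mul (by positivity)]
  ring

/-- Where the posterior variance vanishes, the posterior mean of pure noise does. -/
lemma posteriorMean_eq_zero_of_posteriorVar {φ : X → E}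
    (hφ : ∀ a b, k a b = inner ℝ (φ a) (φ b)) (hρ : ∀ a, 0 < ρ a) (x : Fin n → X)
    (e : Fin n → ℝ) {z : X} (h : posteriorVar k ρ x z = 0) : posteriorMean k ρ x e z = 0 := by
  rw [posteriorVar, posteriorKernel_eq_inner hφ hρ, inner_self_eq_zero, posteriorFeature] at h
  have := inner_resid_obsVec hφ hρ x (liftVec n (φ z)) (noiseVec E ρ x e)
  rw [h, inner_zero_left, inner_liftVec_noiseVec, zero_sub] at this
  simp only [inner_obsVec_noiseVec φ hρ, inner_liftVec_obsVec, ← hφ] at this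
  exact neg_eq_zero.1 this.symm

/-- In the logarithm of the ratio, the determinants contribute minus the total information at `x`,
hence at least `-γ_n`. -/
lemma noiseForm_le {φ : X → E} (hφ : ∀ a b, k a b = inner ℝ (φ a) (φ b))
    (hρ : ∀ a, 0 < ρ a) (hγ : ∀ n, BddAbove (totalInfoValues k ρ n)) {δ : ℝ}
    (x : Fin n → X) (e : Fin n → ℝ) (h : likelihoodRatio k ρ x e < 1 / δ) :
    noiseForm k ρ x e ≤ 2 * (totalInfoCapacity k ρ n + Real.log (1 / δ)) := by
  have hd := noiseCov_det_pos hρ x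
  have hd' := obsCov_det_pos hφ hρ x
  have h1 : (1 / 2) * Real.log (1 + (noiseCov ρ x)⁻¹ * gram k x x).det ≤
      totalInfoCapacity k ρ n := le_csSup (hγ n) ⟨n, le_rfl, x, rfl⟩
  have h2 : (1 + (noiseCov ρ x)⁻¹ * gram k x x).det =
      (obsCov k ρ x).det / (noiseCov ρ x).det := by
    rw [eq_div_iff hd.ne', mul_comm, ← Matrix.det_mul, mul_add, ← mul_assoc,
      Matrix.mul_nonsing_inv _ hd.ne'.isUnit, mul_one, one_mul, add_comm, obsCov]
  have hpos : 0 < likelihoodRatio k ρ x e := by unfold likelihoodRatio; positivity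
  have h3 := Real.log_lt_log hpos h
  rw [likelihoodRatio, Real.log_mul (by positivity) (Real.exp_pos _).ne', Real.log_exp,
    Real.log_sqrt (by positivity), Real.log_div hd.ne' hd'.ne'] at h3
  rw [h2, Real.log_div hd'.ne' hd.ne'] at h1
  linarith

end LikelihoodRatio

/-! ### Conditional expectation of one likelihood factor -/

section Mixture

open ProbabilityTheory

lemma ratioStep_of_var_zero {r : ℝ} (hr : 0 < r) (y : ℝ) : ratioStep 0 0 r y = 1 := by
  have : r ^ 2 ≠ 0 := (pow_pos hr 2).ne'
  simp [ratioStep, this]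

/-- The likelihood ratio is a Gaussian mixture of exponential likelihood ratios. -/
lemma ratioStep_eq_lintegral (m y : ℝ) {v r : ℝ} (hv : 0 < v) (hr : 0 < r) :
    ENNReal.ofReal (ratioStep m v r y) =
      ∫⁻ t : ℝ, ENNReal.ofReal (Real.exp (t * y - t ^ 2 * r ^ 2 / 2)) *
        gaussianPDF (m / r ^ 2) (v / r ^ 4).toNNReal t := by
  -- The factor `exp (t y - t² r² / 2)` is the density ratio of means `t r²` and `0`. With prior
  -- `N(m, v)` on `t r²`, the posterior of `t` given `y` is `N(m', v')`; Bayes' rule is the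
  -- pointwise identity `hpt`.
  set v' : ℝ := v / (r ^ 2 * (v + r ^ 2)) with hv'
  set m' : ℝ := (m * r ^ 2 + y * v) / (r ^ 2 * (v + r ^ 2)) with hm'
  have hv'0 : 0 < v' := by positivity
  have hpt : ∀ t : ℝ, ENNReal.ofReal (Real.exp (t * y - t ^ 2 * r ^ 2 / 2)) *
      gaussianPDF (m / r ^ 2) (v / r ^ 4).toNNReal t =
      ENNReal.ofReal (ratioStep m v r y) * gaussianPDF m' v'.toNNReal t := by
    intro t
    simp only [gaussianPDF]
    rw [← ENNReal.ofReal_mul (Real.exp_nonneg _),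
      ← ENNReal.ofReal_mul (by unfold ratioStep; positivity)]
    congr 1
    simp only [gaussianPDFReal]
    rw [Real.coe_toNNReal _ (by positivity), Real.coe_toNNReal _ hv'0.le, ratioStep]
    have e1 : (√(2 * Real.pi * (v / r ^ 4)))⁻¹ =
        √(r ^ 2 / (v + r ^ 2)) * (√(2 * Real.pi * v'))⁻¹ := by
      rw [← Real.sqrt_inv, ← Real.sqrt_inv, ← Real.sqrt_mul (by positivity)]
      congr 1
      rw [hv']
      field_simp
    have e2 : t * y - t ^ 2 * r ^ 2 / 2 + -(t - m / r ^ 2) ^ 2 / (2 * (v / r ^ 4)) =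
        (y ^ 2 / r ^ 2 - (y - m) ^ 2 / (v + r ^ 2)) / 2 + -(t - m') ^ 2 / (2 * v') := by
      rw [hv', hm']
      field_simp
      ring
    calc Real.exp (t * y - t ^ 2 * r ^ 2 / 2) * ((√(2 * Real.pi * (v / r ^ 4)))⁻¹ *
          Real.exp (-(t - m / r ^ 2) ^ 2 / (2 * (v / r ^ 4))))
        = (√(2 * Real.pi * (v / r ^ 4)))⁻¹ * Real.exp (t * y - t ^ 2 * r ^ 2 / 2 +
            -(t - m / r ^ 2) ^ 2 / (2 * (v / r ^ 4))) := by rw [Real.exp_add]; ring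
      _ = _ := by rw [e1, e2, Real.exp_add]; ring
  simp only [hpt]
  rw [lintegral_const_mul _ (measurable_gaussianPDF _ _),
    lintegral_gaussianPDF_eq_one _ (by simpa using hv'0), mul_one]

variable {Ω : Type*} {F m0 : MeasurableSpace Ω} {P : Measure Ω} [IsProbabilityMeasure P]

/-- A conditional bound on an expectation, with a nonnegative weight known in advance. -/
lemma lintegral_mul_le_of_condExp_le (hF : F ≤ m0) {Z b : Ω → ℝ} (hZ : Measurable Z)
    (hb : Measurable b) (hZ0 : 0 ≤ Z)
    (hZi : Integrable Z P) (h : P[Z | F] ≤ᵐ[P] b) {g : Ω → ENNReal} (hg : Measurable[F] g) :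
    ∫⁻ ω, g ω * ENNReal.ofReal (Z ω) ∂P ≤ ∫⁻ ω, g ω * ENNReal.ofReal (b ω) ∂P := by
  -- Comparing the measures with densities `Z` and `b` on `F` allows any extended nonnegative weight
  -- `g`, without integrability.
  have hle : (P.withDensity fun ω => ENNReal.ofReal (Z ω)).trim hF ≤
      (P.withDensity fun ω => ENNReal.ofReal (b ω)).trim hF := by
    rw [Measure.le_iff]
    intro s hs
    rw [trim_measurableSet_eq hF hs, trim_measurableSet_eq hF hs,
      withDensity_apply _ (hF s hs), withDensity_apply _ (hF s hs),
      ← ofReal_integral_eq_lintegral_ofReal hZi.integrableOn (Filter.Eventually.of_forall hZ0),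
      ← setIntegral_condExp hF hZi hs,
      ofReal_integral_eq_lintegral_ofReal integrable_condExp.integrableOn
        (ae_restrict_of_ae (condExp_nonneg (Filter.Eventually.of_forall hZ0)))]
    refine lintegral_mono_ae (ae_restrict_of_ae ?_)
    filter_upwards [h] with ω hω
    exact ENNReal.ofReal_le_ofReal hω
  have := lintegral_mono' hle (le_refl g)
  rw [lintegral_trim hF hg, lintegral_trim hF hg,
    lintegral_withDensity_eq_lintegral_mul _ hZ.ennreal_ofReal (hg.mono hF le_rfl),
    lintegral_withDensity_eq_lintegral_mul _ hb.ennreal_ofReal (hg.mono hF le_rfl)] at this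
  simpa only [Pi.mul_apply, mul_comm] using this

/-- The likelihood ratio of a conditionally sub-Gaussian variable, against a Gaussian alternative
that is known in advance, has conditional expectation at most one. -/
lemma lintegral_mul_ratioStep_le (hF : F ≤ m0) {Y : Ω → ℝ} (hY : Measurable Y)
    {m v r : Ω → ℝ} (hm : Measurable[F] m) (hv : Measurable[F] v) (hr : Measurable[F] r)
    (hv0 : ∀ ω, 0 ≤ v ω) (hr0 : ∀ ω, 0 < r ω) (hvm : ∀ ω, v ω = 0 → m ω = 0)
    (h : ∀ t : ℝ, Integrable (fun ω => Real.exp (t * Y ω)) P ∧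
      P[fun ω => Real.exp (t * Y ω) | F] ≤ᵐ[P] fun ω => Real.exp (t ^ 2 * r ω ^ 2 / 2))
    {g : Ω → ENNReal} (hg : Measurable[F] g) :
    ∫⁻ ω, g ω * ENNReal.ofReal (ratioStep (m ω) (v ω) (r ω) (Y ω)) ∂P ≤ ∫⁻ ω, g ω ∂P := by
  -- At `v = 0` the mixing law has no density, but there `m = 0` and the ratio is one.
  have hs : MeasurableSet[F] {ω | v ω = 0} := hv (measurableSet_singleton 0)
  rw [← lintegral_add_compl _ (hF _ hs), ← lintegral_add_compl g (hF _ hs)]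
  refine add_le_add (le_of_eq ?_) ?_
  · refine setLIntegral_congr_fun (hF _ hs) fun ω hω => ?_
    have hω' : v ω = 0 := hω
    simp only [hω', hvm ω hω', ratioStep_of_var_zero (hr0 ω), ENNReal.ofReal_one, mul_one]
  · have hm' := hm.mono hF le_rfl
    have hv' := hv.mono hF le_rfl
    have hr' := hr.mono hF le_rfl
    have hg' := hg.mono hF le_rfl
    set G : Ω → ENNReal := {ω | v ω = 0}ᶜ.indicator g with hG
    have hGm : Measurable[F] G := hg.indicator hs.compl
    have hGm' := hGm.mono hF le_rfl
    rw [← lintegral_indicator (hF _ hs).compl, ← lintegral_indicator (hF _ hs).compl, ← hG]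
    have hpdf : ∀ (F' : MeasurableSpace Ω), Measurable[F'] m → Measurable[F'] v →
        Measurable[F'] r → Measurable[F'.prod inferInstance] fun p : Ω × ℝ =>
          gaussianPDF (m p.1 / r p.1 ^ 2) (v p.1 / r p.1 ^ 4).toNNReal p.2 := by
      intro F' _ _ _
      simp only [gaussianPDF, gaussianPDFReal]
      fun_prop
    have hpdfF : ∀ t, Measurable[F] fun ω =>
        gaussianPDF (m ω / r ω ^ 2) (v ω / r ω ^ 4).toNNReal t := by
      intro t
      simp only [gaussianPDF, gaussianPDFReal]
      fun_prop
    calc ∫⁻ ω, {ω | v ω = 0}ᶜ.indicator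
          (fun ω => g ω * ENNReal.ofReal (ratioStep (m ω) (v ω) (r ω) (Y ω))) ω ∂P
        = ∫⁻ ω, (∫⁻ t : ℝ, G ω * (ENNReal.ofReal (Real.exp (t * Y ω - t ^ 2 * r ω ^ 2 / 2)) *
            gaussianPDF (m ω / r ω ^ 2) (v ω / r ω ^ 4).toNNReal t)) ∂P := by
          refine lintegral_congr fun ω => ?_
          by_cases hω : v ω = 0
          · simp [hG, hω]
          · have hω' : ω ∈ {ω | v ω = 0}ᶜ := hω
            rw [lintegral_const_mul _ (by simp only [gaussianPDF, gaussianPDFReal]; fun_prop),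
              ← ratioStep_eq_lintegral _ _ ((hv0 ω).lt_of_ne' hω) (hr0 ω), hG,
              Set.indicator_of_mem hω', Set.indicator_of_mem hω']
      -- With `t` outside, the conditional bound is used for one `t` at a time, so its null set may
      -- depend on `t`.
      _ = ∫⁻ t : ℝ, (∫⁻ ω, G ω * (ENNReal.ofReal (Real.exp (t * Y ω - t ^ 2 * r ω ^ 2 / 2)) *
            gaussianPDF (m ω / r ω ^ 2) (v ω / r ω ^ 4).toNNReal t) ∂P) := by
          refine lintegral_lintegral_swap (Measurable.aemeasurable ?_)
          have := hpdf m0 hm' hv' hr'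
          simp only [Function.uncurry_def]
          fun_prop
      _ ≤ ∫⁻ t : ℝ, (∫⁻ ω, G ω *
            gaussianPDF (m ω / r ω ^ 2) (v ω / r ω ^ 4).toNNReal t ∂P) := by
          refine lintegral_mono fun t => ?_
          have hw : Measurable[F] fun ω => G ω * (ENNReal.ofReal
              (Real.exp (-(t ^ 2 * r ω ^ 2 / 2))) *
              gaussianPDF (m ω / r ω ^ 2) (v ω / r ω ^ 4).toNNReal t) := by
            have := hpdfF t
            fun_prop
          have key := lintegral_mul_le_of_condExp_le hF (Z := fun ω => Real.exp (t * Y ω))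
            (b := fun ω => Real.exp (t ^ 2 * r ω ^ 2 / 2)) (by fun_prop) (by fun_prop)
            (fun ω => (Real.exp_pos _).le) (h t).1 (h t).2 hw
          calc _ = _ := lintegral_congr fun ω => ?_
            _ ≤ _ := key
            _ = _ := lintegral_congr fun ω => ?_
          · rw [sub_eq_add_neg, Real.exp_add, ENNReal.ofReal_mul (Real.exp_nonneg _)]
            ring
          · have : ENNReal.ofReal (Real.exp (-(t ^ 2 * r ω ^ 2 / 2))) *
                ENNReal.ofReal (Real.exp (t ^ 2 * r ω ^ 2 / 2)) = 1 := by
              rw [← ENNReal.ofReal_mul (Real.exp_nonneg _), ← Real.exp_add]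
              simp
            calc _ = G ω * gaussianPDF (m ω / r ω ^ 2) (v ω / r ω ^ 4).toNNReal t *
                  (ENNReal.ofReal (Real.exp (-(t ^ 2 * r ω ^ 2 / 2))) *
                    ENNReal.ofReal (Real.exp (t ^ 2 * r ω ^ 2 / 2))) := by ring
              _ = _ := by rw [this, mul_one]
      _ = ∫⁻ ω, (∫⁻ t : ℝ, G ω *
            gaussianPDF (m ω / r ω ^ 2) (v ω / r ω ^ 4).toNNReal t) ∂P := by
          refine (lintegral_lintegral_swap (Measurable.aemeasurable ?_)).symm
          have := hpdf m0 hm' hv' hr'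
          simp only [Function.uncurry_def]
          fun_prop
      _ ≤ ∫⁻ ω, G ω ∂P := by
          refine lintegral_mono fun ω => ?_
          by_cases hω : v ω = 0
          · simp [hG, hω]
          · rw [lintegral_const_mul _ (measurable_gaussianPDF _ _), lintegral_gaussianPDF_eq_one,
              mul_one]
            have h1 := (hv0 ω).lt_of_ne' hω
            have h2 := hr0 ω
            have : 0 < v ω / r ω ^ 4 := by positivity
            simpa using this

end Mixture

/-! ### Ville's inequality -/

section Ville

variable {Ω : Type*} {m0 : MeasurableSpace Ω} {P : Measure Ω}

/-- **Ville's inequality** for nonnegative processes that decrease in expectation on the events of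
the past. -/
lemma ville_inequality {F : ℕ → MeasurableSpace Ω} (hF : ∀ n, F n ≤ m0) (hmono : Monotone F)
    {M : ℕ → Ω → ENNReal} (hM : ∀ n, Measurable[F n] (M n))
    (hstep : ∀ n s, MeasurableSet[F n] s → ∫⁻ ω in s, M (n + 1) ω ∂P ≤ ∫⁻ ω in s, M n ω ∂P)
    (c : ENNReal) :
    c * P {ω | ∃ n, c ≤ M n ω} ≤ ∫⁻ ω, M 0 ω ∂P := by
  set B : ℕ → Set Ω := fun n => {ω | ∃ i ≤ n, c ≤ M i ω} with hB
  have hBm : ∀ n, MeasurableSet[F n] (B n) := by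
    intro n
    have : B n = ⋃ i ∈ Set.Iic n, {ω | c ≤ M i ω} := by ext ω; simp [hB]
    rw [this]
    refine MeasurableSet.biUnion (Set.to_countable _) fun i hi => ?_
    exact hmono hi _ (hM i measurableSet_Ici)
  have hc : ∀ n s, MeasurableSet s → s ⊆ {ω | c ≤ M n ω} → c * P s ≤ ∫⁻ ω in s, M n ω ∂P := by
    intro n s hs hsub
    rw [← setLIntegral_const]
    exact setLIntegral_mono' hs fun ω hω => hsub hω
  -- This is the process stopped on reaching `c`: paths in `B n` count `c`, the others their current
  -- value. At each step the newly crossing paths pay `c` out of `M (n + 1)`.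
  have hind : ∀ n, c * P (B n) + ∫⁻ ω in (B n)ᶜ, M n ω ∂P ≤ ∫⁻ ω, M 0 ω ∂P := by
    intro n
    induction n with
    | zero =>
      rw [← lintegral_add_compl (μ := P) (M 0) (hF 0 _ (hBm 0))]
      refine add_le_add (hc 0 _ (hF 0 _ (hBm 0)) ?_) le_rfl
      rintro ω ⟨i, hi, h⟩
      obtain rfl := Nat.le_zero.1 hi
      exact h
    | succ n ih =>
      refine le_trans ?_ ih
      set D := {ω | c ≤ M (n + 1) ω} with hD
      have hDm : MeasurableSet D := hF (n + 1) _ (hM (n + 1) measurableSet_Ici)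
      have hBs : B (n + 1) = B n ∪ ((B n)ᶜ ∩ D) := by
        ext ω
        simp only [hB, hD, Set.mem_union, Set.mem_inter_iff, Set.mem_compl_iff, Set.mem_ofPred_eq,
          Nat.le_succ_iff]
        constructor
        · rintro ⟨i, hi | rfl, h⟩
          · exact Or.inl ⟨i, hi, h⟩
          · by_cases h' : ∃ i ≤ n, c ≤ M i ω
            · exact Or.inl h'
            · exact Or.inr ⟨h', h⟩
        · rintro (⟨i, hi, h⟩ | ⟨_, h⟩)
          · exact ⟨i, Or.inl hi, h⟩
          · exact ⟨n + 1, Or.inr rfl, h⟩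
      have hBc : (B (n + 1))ᶜ = (B n)ᶜ \ D := by
        rw [hBs]
        ext ω
        simp only [Set.mem_compl_iff, Set.mem_union, Set.mem_inter_iff, Set.mem_sdiff]
        tauto
      have hBn := hF n _ (hBm n)
      calc c * P (B (n + 1)) + ∫⁻ ω in (B (n + 1))ᶜ, M (n + 1) ω ∂P
          ≤ c * P (B n) + (c * P ((B n)ᶜ ∩ D) + ∫⁻ ω in (B n)ᶜ \ D, M (n + 1) ω ∂P) := by
            rw [← add_assoc, ← mul_add, hBc]
            gcongr
            rw [hBs]
            exact measure_union_le _ _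
        _ ≤ c * P (B n) + (∫⁻ ω in (B n)ᶜ ∩ D, M (n + 1) ω ∂P +
              ∫⁻ ω in (B n)ᶜ \ D, M (n + 1) ω ∂P) := by
            gcongr
            exact hc (n + 1) _ (hBn.compl.inter hDm) Set.inter_subset_right
        _ = c * P (B n) + ∫⁻ ω in (B n)ᶜ, M (n + 1) ω ∂P := by
            rw [lintegral_inter_add_sdiff _ _ hDm]
        _ ≤ c * P (B n) + ∫⁻ ω in (B n)ᶜ, M n ω ∂P :=
            add_le_add le_rfl (hstep n _ (hBm n).compl)
  have hU : {ω | ∃ n, c ≤ M n ω} = ⋃ n, B n := by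
    ext ω
    simp only [hB, Set.mem_ofPred_eq, Set.mem_iUnion]
    exact ⟨fun ⟨n, h⟩ => ⟨n, n, le_rfl, h⟩, fun ⟨_, i, _, h⟩ => ⟨i, h⟩⟩
  have hBmono : Monotone B := fun a b hab ω ⟨i, hi, h⟩ => ⟨i, hi.trans hab, h⟩
  rw [hU, hBmono.measure_iUnion, ENNReal.mul_iSup]
  exact iSup_le fun n => le_self_add.trans (hind n)

end Ville

/-! ### Measurability and the time-uniform noise bound -/

section History

variable {X : Type*} [MeasurableSpace X] {Ω : Type*}

lemma history_mono (x : ℕ → Ω → X) (ε : ℕ → Ω → ℝ) : Monotone (history x ε) := by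
  refine monotone_nat_of_le_succ fun n => ?_
  refine sup_le (iSup_le fun i => ?_) ?_
  · exact (le_iSup (fun i : Fin (n + 1) => MeasurableSpace.comap (x i) inferInstance ⊔
      MeasurableSpace.comap (ε i) inferInstance) i.castSucc).trans le_sup_left
  · exact le_sup_left.trans ((le_iSup (fun i : Fin (n + 1) =>
      MeasurableSpace.comap (x i) inferInstance ⊔
      MeasurableSpace.comap (ε i) inferInstance) (Fin.last n)).trans le_sup_left)

lemma history_le [m0 : MeasurableSpace Ω] {x : ℕ → Ω → X} {ε : ℕ → Ω → ℝ}
    (hx : ∀ n, Measurable (x n)) (hε : ∀ n, Measurable (ε n)) (n : ℕ) : history x ε n ≤ m0 :=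
  sup_le (iSup_le fun i => sup_le (hx i).comap_le (hε i).comap_le) (hx n).comap_le

lemma measurable_history_point (x : ℕ → Ω → X) (ε : ℕ → Ω → ℝ) {i n : ℕ} (h : i ≤ n) :
    Measurable[history x ε n] (x i) :=
  (Measurable.of_comap_le (le_sup_right : _ ≤ history x ε i)).mono (history_mono x ε h) le_rfl

lemma measurable_history_noise (x : ℕ → Ω → X) (ε : ℕ → Ω → ℝ) {i n : ℕ} (h : i < n) :
    Measurable[history x ε n] (ε i) :=
  Measurable.of_comap_le ((le_sup_right.trans (le_iSup (fun i : Fin n =>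
    MeasurableSpace.comap (x i) inferInstance ⊔ MeasurableSpace.comap (ε i) inferInstance)
      ⟨i, h⟩)).trans le_sup_left)

/-- Functions of the past that are measurable in the noise are measurable, if the points lie in a
finite set. -/
lemma measurable_history_comp [MeasurableSingletonClass X] {S : Finset X} {x : ℕ → Ω → X}
    (hS : ∀ n ω, x n ω ∈ S) (ε : ℕ → Ω → ℝ) (n : ℕ) {F : (Fin (n + 1) → X) → (Fin n → ℝ) → ℝ}
    (hF : ∀ z, Measurable (F z)) :
    Measurable[history x ε n] fun ω => F (fun i => x i ω) (fun i => ε i ω) := by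
  -- The points take countably many joint values, so no measurability of `k` or `ρ` is needed.
  have h1 : Measurable fun p : (Fin n → ℝ) × (Fin (n + 1) → S) =>
      F (fun i => p.2 i) p.1 :=
    measurable_from_prod_countable_left fun z => hF fun i => z i
  have h2 : Measurable[history x ε n] fun ω =>
      ((fun i => ε i ω, fun i => ⟨x i ω, hS i ω⟩) : (Fin n → ℝ) × (Fin (n + 1) → S)) := by
    let := history x ε n
    refine Measurable.prodMk ?_ ?_
    · exact measurable_pi_lambda _ fun i => measurable_history_noise x ε i.2
    · exact measurable_pi_lambda _ fun i =>
        (measurable_history_point x ε (Nat.lt_succ_iff.1 i.2)).subtype_mk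
  exact h1.comp h2

lemma measurable_mulVec {m n : ℕ} (M : Matrix (Fin m) (Fin n) ℝ) :
    Measurable fun e : Fin n → ℝ => M.mulVec e := by
  refine measurable_pi_lambda _ fun i => ?_
  unfold Matrix.mulVec dotProduct
  fun_prop

lemma measurable_posteriorMean {X : Type*} (k : X → X → ℝ) (ρ : X → ℝ) {n : ℕ} (x : Fin n → X)
    (a : X) : Measurable fun e : Fin n → ℝ => posteriorMean k ρ x e a := by
  have := measurable_mulVec (gram k x x + noiseCov ρ x)⁻¹
  unfold posteriorMean dotProduct
  fun_prop

lemma measurable_likelihoodRatio {X : Type*} (k : X → X → ℝ) (ρ : X → ℝ) {n : ℕ}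
    (x : Fin n → X) : Measurable fun e : Fin n → ℝ => likelihoodRatio k ρ x e := by
  have := measurable_mulVec (obsCov k ρ x)⁻¹
  unfold likelihoodRatio noiseForm dotProduct
  fun_prop

variable {E : Type*} [NormedAddCommGroup E] [InnerProductSpace ℝ E]
  {k : X → X → ℝ} {ρ : X → ℝ}

/-- With probability at least `1 - δ`, the likelihood ratio never reaches `1 / δ`. -/
theorem likelihoodRatio_lt [MeasurableSingletonClass X] [MeasurableSpace Ω] {P : Measure Ω}
    [IsProbabilityMeasure P] {φ : X → E} (hφ : ∀ a b, k a b = inner ℝ (φ a) (φ b))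
    (hρ : ∀ a, 0 < ρ a) {S : Finset X} {x : ℕ → Ω → X} {ε : ℕ → Ω → ℝ}
    (hS : ∀ n ω, x n ω ∈ S) (hx : ∀ n, Measurable (x n)) (hε : ∀ n, Measurable (ε n))
    (hsg : IsCondSubGaussian P ρ x ε) {δ : ℝ} (hδ : 0 < δ) :
    1 - δ ≤ P.real {ω | ∀ n, likelihoodRatio k ρ (fun i : Fin n => x i ω)
      (fun i : Fin n => ε i ω) < 1 / δ} := by
  set M : ℕ → Ω → ENNReal := fun n ω => ENNReal.ofReal
    (likelihoodRatio k ρ (fun i : Fin n => x i ω) (fun i : Fin n => ε i ω)) with hM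
  have hMm : ∀ n, Measurable[history x ε n] (M n) := by
    intro n
    refine Measurable.ennreal_ofReal ?_
    -- The history at time `n` already contains the point `x n`, which the ratio of the first `n`
    -- values does not use; hence `castSucc`.
    exact measurable_history_comp hS ε n
      (F := fun z e => likelihoodRatio k ρ (fun i : Fin n => z i.castSucc) e)
      fun z => measurable_likelihoodRatio k ρ _
  have hle := history_le hx hε
  have hstep : ∀ n s, MeasurableSet[history x ε n] s →
      ∫⁻ ω in s, M (n + 1) ω ∂P ≤ ∫⁻ ω in s, M n ω ∂P := by
    intro n s hs
    have key := lintegral_mul_ratioStep_le (P := P) (hle n) (hε n)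
      (m := fun ω => posteriorMean k ρ (fun i : Fin n => x i ω) (fun i : Fin n => ε i ω) (x n ω))
      (v := fun ω => posteriorVar k ρ (fun i : Fin n => x i ω) (x n ω))
      (r := fun ω => ρ (x n ω))
      (measurable_history_comp hS ε n
        (F := fun z e => posteriorMean k ρ (fun i : Fin n => z i.castSucc) e (z (Fin.last n)))
        fun z => measurable_posteriorMean k ρ _ _)
      (measurable_history_comp hS ε n
        (F := fun z e => posteriorVar k ρ (fun i : Fin n => z i.castSucc) (z (Fin.last n)))
        fun z => measurable_const)
      (measurable_history_comp hS ε n (F := fun z e => ρ (z (Fin.last n)))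
        fun z => measurable_const)
      (fun ω => posteriorVar_nonneg hφ hρ _ _) (fun ω => hρ _)
      (fun ω h => posteriorMean_eq_zero_of_posteriorVar hφ hρ _ _ h)
      (fun t => hsg n t) ((hMm n).indicator hs)
    rw [← lintegral_indicator (hle n s hs), ← lintegral_indicator (hle n s hs)]
    refine le_trans (le_of_eq (lintegral_congr fun ω => ?_)) key
    by_cases hω : ω ∈ s
    · rw [Set.indicator_of_mem hω, Set.indicator_of_mem hω, hM]
      simp only
      rw [← ENNReal.ofReal_mul (likelihoodRatio_nonneg _ _)]
      congr 1
      exact likelihoodRatio_succ hφ hρ (fun i => x i ω) (fun i => ε i ω) n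
    · rw [Set.indicator_of_notMem hω, Set.indicator_of_notMem hω, zero_mul]
  have hville := ville_inequality hle (history_mono x ε) hMm hstep (ENNReal.ofReal (1 / δ))
  have hM0 : ∫⁻ ω, M 0 ω ∂P = 1 := by
    simp [hM, likelihoodRatio_empty]
  rw [hM0] at hville
  set bad := {ω | ∃ n, ENNReal.ofReal (1 / δ) ≤ M n ω} with hbad
  have hbadm : MeasurableSet bad := by
    have : bad = ⋃ n, {ω | ENNReal.ofReal (1 / δ) ≤ M n ω} := by ext; simp [hbad]
    rw [this]
    exact MeasurableSet.iUnion fun n => hle n _ (hMm n measurableSet_Ici)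
  have hgood : {ω | ∀ n, likelihoodRatio k ρ (fun i : Fin n => x i ω)
      (fun i : Fin n => ε i ω) < 1 / δ} = badᶜ := by
    ext ω
    simp only [hbad, hM, Set.mem_ofPred_eq, Set.mem_compl_iff, not_exists, not_le]
    exact forall_congr' fun n => (ENNReal.ofReal_lt_ofReal_iff (by positivity)).symm
  rw [hgood, probReal_compl_eq_one_sub hbadm]
  have h1 : 1 / δ * P.real bad ≤ 1 := by
    have := ENNReal.toReal_mono ENNReal.one_ne_top hville
    rwa [ENNReal.toReal_mul, ENNReal.toReal_ofReal (by positivity), ENNReal.toReal_one] at this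
  have h2 : P.real bad ≤ δ := by
    rw [one_div, inv_mul_le_iff₀ hδ, mul_one] at h1
    exact h1
  linarith

end History

end TransductiveLearning
-- The main theorem
open TransductiveLearning in
theorem mainTheorem2
    {X : Type*} [MeasurableSpace X] [MeasurableSingletonClass X]
    {H : Type*} [NormedAddCommGroup H] [InnerProductSpace ℝ H] [CompleteSpace H]
    [RKHS ℝ H X ℝ]
    (k : X → X → ℝ) (hk : ∀ a b, k a b = RKHS.kernel H a b 1) (hk1 : ∀ a, k a a ≤ 1)
    (ρ : X → ℝ) (hρ : ∀ a, 0 < ρ a) (hρ' : BddAbove (Set.range ρ))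
    (A S : Finset X) (rule : DecisionRule)
    (hsub : IsSubmodular rule k ρ A S)
    (hγ : HasSublinearCapacity k ρ) :
    ∃ C : ℝ, 0 ≤ C ∧
      (∀ x : ℕ → X, IsSelectedBy rule k ρ A S x → ∀ n : ℕ, 1 ≤ n → ∀ a ∈ A,
        posteriorVar k ρ (fun i : Fin n => x i) a ≤
          irreducibleVar k S a + reducibleVar C k ρ A S n) ∧
      ∀ (Ω : Type*) [MeasurableSpace Ω] (P : Measure Ω) [IsProbabilityMeasure P]
        (fstar : H) (δ : ℝ), 0 < δ → δ < 1 →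
        ∀ (x : ℕ → Ω → X) (ε : ℕ → Ω → ℝ),
          (∀ n, Measurable (x n)) → (∀ n, Measurable (ε n)) →
          (∀ ω, IsSelectedBy rule k ρ A S (fun n => x n ω)) →
          IsCondSubGaussian P ρ x ε →
          1 - δ ≤ P.real {ω | ∀ n : ℕ, 1 ≤ n → ∀ a ∈ A,
            |fstar a - posteriorMean k ρ (fun i : Fin n => x i ω)
                (fun i : Fin n => fstar (x i ω) + ε i ω) a| ≤
              confidenceWidth k ρ ‖fstar‖ n δ *
                (√(irreducibleVar k S a) + √(reducibleVar C k ρ A S n))} := by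
  set φ : X → H := fun a => RKHS.kerFun H a 1 with hφdef
  have hφ : ∀ a b, k a b = inner ℝ (φ a) (φ b) := by
    intro a b
    simp only [hφdef, hk, RKHS.kerFun_inner, RKHS.kerFun_apply]
    simp
  have hev : ∀ (f : H) (a : X), f a = inner ℝ (φ a) f := by
    intro f a
    simp [hφdef]
  set R := ⨆ a, ρ a with hR
  have hρR : ∀ a, ρ a ≤ R := fun a => le_ciSup hρ' a
  set C₀ := varConst k A S R (infoCapacity k ρ A S 1) with hC₀
  have hC₀0 : 0 ≤ C₀ := varConst_nonneg _ _ _ _ _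
  -- `noiseForm` is standardised, so its bound lacks the factor `R` of the confidence width.
  -- Enlarging the constant by `1 / R ^ 2` yields `u ≤ R * ν` for the noise term, while `1` keeps `u
  -- ≤ ν` for the norm term.
  set c := max 1 (1 / R ^ 2) with hc
  have hc1 : 1 ≤ c := le_max_left _ _
  have hC : C₀ ≤ C₀ * c := le_mul_of_one_le_right hC₀0 hc1
  refine ⟨C₀ * c, by positivity, ?_, ?_⟩
  · intro x hx n hn a ha
    have h1 := hx.posteriorVar_sub_le hφ hk1 hρ hρR hsub hn ha
    have h2 := reducibleVar_mono hC k ρ A S n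
    linarith
  · intro Ω _ P _ fstar δ hδ _ x ε hx hε hsel hsg
    refine (likelihoodRatio_lt hφ hρ (fun n ω => (hsel ω).mem n) hx hε hsg hδ).trans ?_
    refine measureReal_mono fun ω hω n hn a ha => ?_
    have hR0 : 0 < R := (hρ (x 0 ω)).trans_le (hρR _)
    set B := ‖fstar‖
    have hB : 0 ≤ B := norm_nonneg _
    have hQ := noiseForm_le hφ hρ hγ.1 _ _ (hω n)
    set q := noiseForm k ρ (fun i : Fin n => x i ω) (fun i : Fin n => ε i ω) with hq
    set L := totalInfoCapacity k ρ n + 1 + Real.log (1 / δ) with hL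
    -- The summand `1` in the confidence width is slack here.
    have hqL : √q ≤ √(2 * L) := Real.sqrt_le_sqrt (by linarith)
    have herr := abs_sub_posteriorMean_le hφ hρ (S := S) (fun i : Fin n => (hsel ω).mem i)
      (fun i : Fin n => ε i ω) fstar a
    rw [← hq] at herr
    simp only [← hev] at herr
    have hvar := (hsel ω).posteriorVar_sub_le hφ hk1 hρ hρR hsub hn ha
    set η := √(irreducibleVar k S a)
    have hη : 0 ≤ η := Real.sqrt_nonneg _
    set ν := √(reducibleVar (C₀ * c) k ρ A S n) with hν
    set u := √(posteriorVar k ρ (fun i : Fin n => x i ω) a - irreducibleVar k S a) with hu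
    have hu1 : u ≤ ν := Real.sqrt_le_sqrt (hvar.trans (reducibleVar_mono hC k ρ A S n))
    have hu2 : u ≤ R * ν := by
      have h1 : reducibleVar C₀ k ρ A S n ≤ R ^ 2 * reducibleVar (C₀ * c) k ρ A S n := by
        have h2 : 1 ≤ R ^ 2 * c := by
          calc 1 = R ^ 2 * (1 / R ^ 2) := by field_simp
            _ ≤ R ^ 2 * c := by gcongr; exact le_max_right _ _
        have h3 : R ^ 2 * reducibleVar (C₀ * c) k ρ A S n =
            R ^ 2 * c * reducibleVar C₀ k ρ A S n := by
          unfold reducibleVar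
          ring
        rw [h3]
        exact le_mul_of_one_le_left (reducibleVar_nonneg hC₀0 k ρ A S n) h2
      rw [hu, hν, ← Real.sqrt_sq hR0.le, ← Real.sqrt_mul (sq_nonneg R)]
      exact Real.sqrt_le_sqrt (hvar.trans h1)
    have hu0 : 0 ≤ u := Real.sqrt_nonneg _
    calc _ ≤ B * η + u * (B + √q) := herr
      _ = B * η + B * u + u * √q := by ring
      _ ≤ B * η + B * ν + R * ν * √(2 * L) := by gcongr
      -- The missing nonnegative cross term completes the product of the width with `η + ν`.
      _ ≤ B * η + B * ν + R * ν * √(2 * L) + R * √(2 * L) * η := by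
          have : 0 ≤ R * √(2 * L) * η := by positivity
          linarith
      _ = confidenceWidth k ρ B n δ * (η + ν) := by
          rw [confidenceWidth, ← hR, ← hL]
          ring
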